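/- Let $1<p<\infty$ and $0<G_0\le G_1$. There is a constant $c>0$, depending only on $p,G_0,G_1$, such that the following holds for all $L>0$ and $M>0$. Let $$A(M)=\{G\in C^1(\mathbb R):\ G\text{ is }L\text{-periodic},\ G_0\le G\le G_1,\ |G'|\le M\}.$$ For $G\in A(M)$ let $Y^*_G=\{(y_1,y_2): 0<y_1<L,\ 0<y_2<G(y_1)\}$, let $W^{1,p}_{\#,0}(Y^*_G)$ be the space of all $\varphi\in W^{1,p}(Y^*_G)$ with zero average whose traces on the sides $y_1=0$ and $y_1=L$ coincide, let $v=v_G$ be the solution of $$v-y_1\in W^{1,p}_{\#,0}(Y^*_G),\qquad \int_{Y^*_G}|\nabla v|^{p-2}\nabla v\cdot\nabla\varphi\,dy=0\quad\text{for all }\varphi\in W^{1,p}_{\#,0}(Y^*_G),$$ and let $q(G)=\int_{Y^*_G}|\nabla v|^{p-2}\partial_{y_1}v\,dy$. Put $\alpha=1/2$ if $1<p<2$ and $\alpha=1/p$ if $p\ge2$. Then for each $\varepsilon>0$ there is $\delta>0$ such that, for all $G,\bar G\in A(M)$ with $\|\bar G-G\|_{C^1}=\sup|\bar G-G|+\sup|\bar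 G'-G'|\le\delta$, with $v=v_G$ and with $\bar v=v_{\bar G}$ transported to $Y^*_G$, i.e. $\bar V(z_1,z_2)=v_{\bar G}\bigl(z_1,\tfrac{\bar G(z_1)}{G(z_1)}z_2\bigr)$, one has $\bar V\in W^{1,p}(Y^*_G)$, $$\|\nabla\bar V-\nabla v\|_{L^p(Y^*_G)}\le c(\varepsilon+\varepsilon^{\alpha})\qquad\text{and}\qquad |q(\bar G)-q(G)|\le c(\varepsilon+\varepsilon^{\alpha}).$$ -/

import Mathlib

open MeasureTheory Set
open scoped ENNReal

noncomputable section

/-- The class `A(M)` of admissible profiles with constants `L, G₀, G₁, M`. -/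
def AdmissibleProfiles (L G₀ G₁ M : ℝ) : Set (ℝ → ℝ) :=
  {G | ContDiff ℝ 1 G ∧ Function.Periodic G L ∧ (∀ s, G₀ ≤ G s ∧ G s ≤ G₁) ∧
    ∀ s, |deriv G s| ≤ M}

/-- The `C¹` norm `sup |f| + sup |f'|`; it is used only for differences of admissible profiles,
for which both suprema are finite. -/
def c1Norm (f : ℝ → ℝ) : ℝ := (⨆ s, |f s|) + ⨆ s, |deriv f s|

/-- The basic cell `Y*_G = {0 < y₁ < L, 0 < y₂ < G(y₁)}`. -/
def basicCell (L : ℝ) (G : ℝ → ℝ) : Set (ℝ × ℝ) :=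
  {y | 0 < y.1 ∧ y.1 < L ∧ 0 < y.2 ∧ y.2 < G y.1}

/-- The unbounded strip `{0 < y₂ < G(y₁)}` containing the cell. -/
def cellStrip (G : ℝ → ℝ) : Set (ℝ × ℝ) := {y | 0 < y.2 ∧ y.2 < G y.1}

/-- `g` is the weak gradient of `u` in `Ω` (test functions in `C¹_c(Ω)`). -/
def HasWeakGradient (Ω : Set (ℝ × ℝ)) (u : ℝ × ℝ → ℝ)
    (g : ℝ × ℝ → EuclideanSpace ℝ (Fin 2)) : Prop :=
  ∀ φ : ℝ × ℝ → ℝ, ContDiff ℝ 1 φ → HasCompactSupport φ → tsupport φ ⊆ Ω →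
    (∫ y in Ω, u y * fderiv ℝ φ y (1, 0)) = -∫ y in Ω, g y 0 * φ y ∧
    (∫ y in Ω, u y * fderiv ℝ φ y (0, 1)) = -∫ y in Ω, g y 1 * φ y

/-- `u ∈ W^{1,p}(Ω)` with weak gradient `g`. -/
structure MemW1p (p : ℝ) (Ω : Set (ℝ × ℝ)) (u : ℝ × ℝ → ℝ)
    (g : ℝ × ℝ → EuclideanSpace ℝ (Fin 2)) : Prop where
  memLp : MemLp u (ENNReal.ofReal p) (volume.restrict Ω)
  memLp_grad : MemLp g (ENNReal.ofReal p) (volume.restrict Ω)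
  weakGrad : HasWeakGradient Ω u g

/-- `wl` and `wr` are the traces of `u ∈ W^{1,p}(Y*_G)` (with weak gradient `g`) on the left side
`{0} × (0, G(0))` and on the right side `{L} × (0, G(L))` of the cell. The traces are the
`L^p` functions given by Green's formula, tested with functions that vanish near the lower and
the upper boundary but not necessarily on the two lateral sides. -/
structure HasLateralTraces (p L : ℝ) (G : ℝ → ℝ) (u : ℝ × ℝ → ℝ)
    (g : ℝ × ℝ → EuclideanSpace ℝ (Fin 2)) (wl wr : ℝ → ℝ) : Prop where
  memLp_left : MemLp wl (ENNReal.ofReal p) (volume.restrict (Ioo 0 (G 0)))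
  memLp_right : MemLp wr (ENNReal.ofReal p) (volume.restrict (Ioo 0 (G L)))
  green : ∀ φ : ℝ × ℝ → ℝ, ContDiff ℝ 1 φ → HasCompactSupport φ → tsupport φ ⊆ cellStrip G →
    (∫ y in basicCell L G, (u y * fderiv ℝ φ y (1, 0) + g y 0 * φ y)) =
      (∫ t in Ioo 0 (G L), wr t * φ (L, t)) - ∫ t in Ioo 0 (G 0), wl t * φ (0, t)

/-- `u ∈ W^{1,p}_#(Y*_G)` with weak gradient `g`: the traces on the left and on the right side
of the cell coincide. -/
def MemW1pPer (p L : ℝ) (G : ℝ → ℝ) (u : ℝ × ℝ → ℝ)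
    (g : ℝ × ℝ → EuclideanSpace ℝ (Fin 2)) : Prop :=
  MemW1p p (basicCell L G) u g ∧ ∃ w : ℝ → ℝ, HasLateralTraces p L G u g w w

/-- `u ∈ W^{1,p}_{#,0}(Y*_G)` with weak gradient `g`: moreover `u` has zero average. -/
def MemW1pPerZero (p L : ℝ) (G : ℝ → ℝ) (u : ℝ × ℝ → ℝ)
    (g : ℝ × ℝ → EuclideanSpace ℝ (Fin 2)) : Prop :=
  MemW1pPer p L G u g ∧ ∫ y in basicCell L G, u y = 0

/-- The `p`-Laplacian flux `|s|^{p-2} s`. -/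
def pFlux (p : ℝ) (s : EuclideanSpace ℝ (Fin 2)) : EuclideanSpace ℝ (Fin 2) :=
  ‖s‖ ^ (p - 2) • s

/-- `v`, with weak gradient `g`, is the solution of the cell problem in `Y*_G`:
`v - y₁ ∈ W^{1,p}_{#,0}(Y*_G)` and `∫ |∇v|^{p-2} ∇v · ∇φ = 0` for all
`φ ∈ W^{1,p}_{#,0}(Y*_G)`. -/
structure IsCellSolution (p L : ℝ) (G : ℝ → ℝ) (v : ℝ × ℝ → ℝ)
    (g : ℝ × ℝ → EuclideanSpace ℝ (Fin 2)) : Prop where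
  sub_mem : MemW1pPerZero p L G (fun y => v y - y.1) (fun y => g y - !₂[(1 : ℝ), 0])
  eq_zero : ∀ (φ : ℝ × ℝ → ℝ) (gφ : ℝ × ℝ → EuclideanSpace ℝ (Fin 2)),
    MemW1pPerZero p L G φ gφ →
      ∫ y in basicCell L G, inner ℝ (pFlux p (g y)) (gφ y) = 0

/-- The homogenized coefficient `q(G) = ∫_{Y*_G} |∇v|^{p-2} ∂_{y₁} v`, where `g = ∇v`. -/
def homogCoeff (p L : ℝ) (G : ℝ → ℝ) (g : ℝ × ℝ → EuclideanSpace ℝ (Fin 2)) : ℝ :=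
  ∫ y in basicCell L G, ‖g y‖ ^ (p - 2) * g y 0

/-- The map `(z₁, z₂) ↦ (z₁, (Ḡ(z₁)/G(z₁)) z₂)` from `Y*_G` onto `Y*_Ḡ`. -/
def cellMap (G Gbar : ℝ → ℝ) (z : ℝ × ℝ) : ℝ × ℝ := (z.1, Gbar z.1 / G z.1 * z.2)

/-- The exponent `α`: `1/2` if `p < 2`, and `1/p` if `p ≥ 2`. -/
def rateExponent (p : ℝ) : ℝ := if p < 2 then 1 / 2 else 1 / p

end

open Filter Topology

section ChangeOfVariables

lemma AdmissibleProfiles.pos {L G₀ G₁ M : ℝ} {G : ℝ → ℝ} (hG₀ : 0 < G₀)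
    (hG : G ∈ AdmissibleProfiles L G₀ G₁ M) (s : ℝ) : 0 < G s :=
  hG₀.trans_le (hG.2.2.1 s).1

lemma isOpen_cellStrip {G : ℝ → ℝ} (hG : Continuous G) : IsOpen (cellStrip G) :=
  (isOpen_lt continuous_const continuous_snd).inter
    (isOpen_lt continuous_snd (hG.comp continuous_fst))

lemma isOpen_basicCell {L : ℝ} {G : ℝ → ℝ} (hG : Continuous G) : IsOpen (basicCell L G) :=
  (isOpen_lt continuous_const continuous_fst).inter <|
    (isOpen_lt continuous_fst continuous_const).inter (isOpen_cellStrip hG)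

lemma basicCell_subset_Icc {L G₀ G₁ M : ℝ} {G : ℝ → ℝ}
    (hG : G ∈ AdmissibleProfiles L G₀ G₁ M) :
    basicCell L G ⊆ Icc 0 L ×ˢ Icc 0 G₁ := fun _ hy =>
  ⟨⟨hy.1.le, hy.2.1.le⟩, hy.2.2.1.le, hy.2.2.2.le.trans (hG.2.2.1 _).2⟩

lemma volume_real_basicCell_le {L G₀ G₁ M : ℝ} {G : ℝ → ℝ} (hL : 0 < L) (hG₀ : 0 < G₀)
    (hG : G ∈ AdmissibleProfiles L G₀ G₁ M) :
    volume.real (basicCell L G) ≤ L * G₁ := by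
  have h1 : 0 ≤ G₁ := (AdmissibleProfiles.pos hG₀ hG 0).le.trans (hG.2.2.1 0).2
  refine (measureReal_mono (basicCell_subset_Icc hG)
    (isCompact_Icc.prod isCompact_Icc).measure_lt_top.ne).trans_eq ?_
  rw [Measure.volume_eq_prod, measureReal_prod_prod, Real.volume_real_Icc_of_le hL.le,
    Real.volume_real_Icc_of_le h1]
  ring

lemma isFiniteMeasure_restrict_basicCell {L G₀ G₁ M : ℝ} {G : ℝ → ℝ}
    (hG : G ∈ AdmissibleProfiles L G₀ G₁ M) :
    IsFiniteMeasure (volume.restrict (basicCell L G)) :=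
  ⟨by
    rw [Measure.restrict_apply_univ]
    exact (measure_mono (basicCell_subset_Icc hG)).trans_lt
      (isCompact_Icc.prod isCompact_Icc).measure_lt_top⟩

lemma cellMap_cellMap {G H : ℝ → ℝ} (hG : ∀ s, 0 < G s) (hH : ∀ s, 0 < H s) (z : ℝ × ℝ) :
    cellMap H G (cellMap G H z) = z := by
  have h1 := (hG z.1).ne'
  have h2 := (hH z.1).ne'
  ext
  · rfl
  · simp only [cellMap]; field_simp

lemma cellMap_mem_cellStrip {G H : ℝ → ℝ} (hG : ∀ s, 0 < G s) (hH : ∀ s, 0 < H s)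
    {z : ℝ × ℝ} : cellMap G H z ∈ cellStrip H ↔ z ∈ cellStrip G := by
  have h1 := hG z.1
  have h2 := hH z.1
  simp only [cellMap, cellStrip, mem_ofPred_eq]
  rw [mul_pos_iff_of_pos_left (div_pos h2 h1), div_mul_eq_mul_div, div_lt_iff₀ h1,
    mul_lt_mul_iff_right₀ h2]

lemma cellMap_mem_basicCell {L : ℝ} {G H : ℝ → ℝ} (hG : ∀ s, 0 < G s) (hH : ∀ s, 0 < H s)
    {z : ℝ × ℝ} : cellMap G H z ∈ basicCell L H ↔ z ∈ basicCell L G :=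
  and_congr_right fun _ => and_congr_right fun _ => cellMap_mem_cellStrip hG hH

lemma image_cellMap_basicCell {L : ℝ} {G H : ℝ → ℝ} (hG : ∀ s, 0 < G s) (hH : ∀ s, 0 < H s) :
    cellMap G H '' basicCell L G = basicCell L H := by
  ext x
  constructor
  · rintro ⟨z, hz, rfl⟩
    exact (cellMap_mem_basicCell hG hH).2 hz
  · intro hx
    exact ⟨cellMap H G x, (cellMap_mem_basicCell hH hG).2 hx, cellMap_cellMap hH hG x⟩

lemma contDiff_div_profile {G H : ℝ → ℝ} (hG : ContDiff ℝ 1 G) (hH : ContDiff ℝ 1 H)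
    (hG0 : ∀ s, 0 < G s) : ContDiff ℝ 1 fun s => H s / G s :=
  hH.div hG fun s => (hG0 s).ne'

lemma contDiff_cellMap {G H : ℝ → ℝ} (hG : ContDiff ℝ 1 G) (hH : ContDiff ℝ 1 H)
    (hG0 : ∀ s, 0 < G s) : ContDiff ℝ 1 (cellMap G H) :=
  contDiff_fst.prodMk (((contDiff_div_profile hG hH hG0).comp contDiff_fst).mul contDiff_snd)

/-- The derivative of `cellMap G H` at `z`. -/
noncomputable def cellMapFDeriv (G H : ℝ → ℝ) (z : ℝ × ℝ) : ℝ × ℝ →L[ℝ] ℝ × ℝ :=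
  (Matrix.toLin (.finTwoProd ℝ) (.finTwoProd ℝ)
    !![1, 0; deriv (fun s => H s / G s) z.1 * z.2, H z.1 / G z.1]).toContinuousLinearMap

lemma hasFDerivAt_cellMap {G H : ℝ → ℝ} (hG : ContDiff ℝ 1 G) (hH : ContDiff ℝ 1 H)
    (hG0 : ∀ s, 0 < G s) (z : ℝ × ℝ) :
    HasFDerivAt (cellMap G H) (cellMapFDeriv G H z) z := by
  unfold cellMapFDeriv
  rw [Matrix.toLin_finTwoProd_toContinuousLinearMap]
  have h := ((contDiff_div_profile hG hH hG0).differentiable one_ne_zero z.1).hasDerivAt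
  convert! HasFDerivAt.prodMk (𝕜 := ℝ) (hasFDerivAt_fst (p := z))
    ((h.comp_hasFDerivAt z hasFDerivAt_fst).mul hasFDerivAt_snd) using 2
  · ext <;> simp
  · ext <;> simp [mul_comm]

lemma det_cellMapFDeriv (G H : ℝ → ℝ) (z : ℝ × ℝ) :
    (cellMapFDeriv G H z).det = H z.1 / G z.1 := by
  unfold cellMapFDeriv
  simp only [LinearMap.det_toContinuousLinearMap, LinearMap.det_toLin, Matrix.det_fin_two_of]
  ring

lemma setIntegral_basicCell_comp {L : ℝ} {G H : ℝ → ℝ} (hG : ContDiff ℝ 1 G)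
    (hH : ContDiff ℝ 1 H) (hG0 : ∀ s, 0 < G s) (hH0 : ∀ s, 0 < H s) (f : ℝ × ℝ → ℝ) :
    ∫ x in basicCell L H, f x = ∫ z in basicCell L G, H z.1 / G z.1 * f (cellMap G H z) := by
  rw [← image_cellMap_basicCell hG0 hH0, integral_image_eq_integral_abs_det_fderiv_smul volume
    (isOpen_basicCell hG.continuous).measurableSet
    (fun z _ => (hasFDerivAt_cellMap hG hH hG0 z).hasFDerivWithinAt)
    (Function.LeftInverse.injective (cellMap_cellMap hG0 hH0)).injOn]
  congr 1
  ext z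
  rw [det_cellMapFDeriv, abs_of_pos (div_pos (hH0 _) (hG0 _)), smul_eq_mul]

lemma integrableOn_basicCell_comp {L : ℝ} {G H : ℝ → ℝ} (hG : ContDiff ℝ 1 G)
    (hH : ContDiff ℝ 1 H) (hG0 : ∀ s, 0 < G s) (hH0 : ∀ s, 0 < H s) (f : ℝ × ℝ → ℝ) :
    IntegrableOn f (basicCell L H) ↔
      IntegrableOn (fun z => H z.1 / G z.1 * f (cellMap G H z)) (basicCell L G) := by
  rw [← image_cellMap_basicCell hG0 hH0, integrableOn_image_iff_integrableOn_abs_det_fderiv_smul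
    volume (isOpen_basicCell hG.continuous).measurableSet
    (fun z _ => (hasFDerivAt_cellMap hG hH hG0 z).hasFDerivWithinAt)
    (Function.LeftInverse.injective (cellMap_cellMap hG0 hH0)).injOn]
  apply iff_of_eq
  congr 1
  ext z
  rw [det_cellMapFDeriv, abs_of_pos (div_pos (hH0 _) (hG0 _)), smul_eq_mul]

lemma quasiMeasurePreserving_cellMap {L : ℝ} {G H : ℝ → ℝ} (hG : ContDiff ℝ 1 G)
    (hH : ContDiff ℝ 1 H) (hG0 : ∀ s, 0 < G s) (hH0 : ∀ s, 0 < H s) :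
    Measure.QuasiMeasurePreserving (cellMap G H) (volume.restrict (basicCell L G))
      (volume.restrict (basicCell L H)) := by
  have hc := (contDiff_cellMap hG hH hG0).continuous.measurable
  refine ⟨hc, ?_⟩
  rw [← image_cellMap_basicCell hG0 hH0, ← map_withDensity_abs_det_fderiv_eq_addHaar volume
    (isOpen_basicCell hG.continuous).measurableSet.nullMeasurableSet
    (fun z _ => (hasFDerivAt_cellMap hG hH hG0 z).hasFDerivWithinAt)
    (Function.LeftInverse.injective (cellMap_cellMap hG0 hH0)).injOn]
  refine Measure.AbsolutelyContinuous.map (withDensity_absolutelyContinuous' ?_ ?_) hc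
  · simp_rw [det_cellMapFDeriv]
    have : Continuous fun z : ℝ × ℝ => H z.1 / G z.1 :=
      (contDiff_div_profile hG hH hG0).continuous.comp continuous_fst
    exact (ENNReal.continuous_ofReal.comp this.abs).aemeasurable
  · refine Eventually.of_forall fun z => ?_
    rw [det_cellMapFDeriv]
    simp [(hG0 z.1).ne', (hH0 z.1).ne']

lemma div_profile_le {L G₀ G₁ M : ℝ} {G H : ℝ → ℝ} (hG₀ : 0 < G₀)
    (hG : G ∈ AdmissibleProfiles L G₀ G₁ M) (hH : H ∈ AdmissibleProfiles L G₀ G₁ M) (s : ℝ) :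
    H s / G s ≤ G₁ / G₀ :=
  div_le_div₀ ((AdmissibleProfiles.pos hG₀ hH s).le.trans (hH.2.2.1 s).2) (hH.2.2.1 s).2 hG₀
    (hG.2.2.1 s).1

lemma memLp_comp_cellMap {F : Type*} [NormedAddCommGroup F] {p L G₀ G₁ M : ℝ} {G H : ℝ → ℝ}
    (hp : 1 < p) (hG₀ : 0 < G₀) (hG : G ∈ AdmissibleProfiles L G₀ G₁ M)
    (hH : H ∈ AdmissibleProfiles L G₀ G₁ M) {f : ℝ × ℝ → F}
    (hf : MemLp f (ENNReal.ofReal p) (volume.restrict (basicCell L H))) :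
    MemLp (fun z => f (cellMap G H z)) (ENNReal.ofReal p) (volume.restrict (basicCell L G)) := by
  have hG0 := AdmissibleProfiles.pos hG₀ hG
  have hH0 := AdmissibleProfiles.pos hG₀ hH
  have hp0 : 0 < p := by linarith
  have hm : AEStronglyMeasurable (fun z => f (cellMap G H z))
      (volume.restrict (basicCell L G)) :=
    hf.1.comp_quasiMeasurePreserving (quasiMeasurePreserving_cellMap hG.1 hH.1 hG0 hH0)
  have hpt : (ENNReal.ofReal p).toReal = p := ENNReal.toReal_ofReal hp0.le
  rw [← integrable_norm_rpow_iff hm (by simpa using hp0) ENNReal.ofReal_ne_top, hpt]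
  have h1 := hf.integrable_norm_rpow (by simpa using hp0) ENNReal.ofReal_ne_top
  rw [hpt] at h1
  have h2 := (integrableOn_basicCell_comp hG.1 hH.1 hG0 hH0 _).1 h1
  refine (h2.const_mul (G₁ / G₀)).mono' (hm.norm.aemeasurable.pow_const p).aestronglyMeasurable
    (Eventually.of_forall fun z => ?_)
  have h3 : G z.1 / H z.1 ≤ G₁ / G₀ := div_profile_le hG₀ hH hG z.1
  have h4 := hG0 z.1
  have h5 := hH0 z.1
  have h6 : 0 ≤ ‖f (cellMap G H z)‖ ^ p := by positivity
  rw [Real.norm_of_nonneg h6, ← mul_assoc]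
  refine le_mul_of_one_le_left h6 ?_
  calc (1 : ℝ) = G z.1 / H z.1 * (H z.1 / G z.1) := by field_simp
    _ ≤ _ := by gcongr

end ChangeOfVariables

section WeakDerivatives

lemma cellMapFDeriv_apply (G H : ℝ → ℝ) (z w : ℝ × ℝ) :
    cellMapFDeriv G H z w =
      (w.1, deriv (fun s => H s / G s) z.1 * z.2 * w.1 + H z.1 / G z.1 * w.2) := by
  unfold cellMapFDeriv
  rw [Matrix.toLin_finTwoProd_toContinuousLinearMap]
  simp

lemma fderiv_comp_cellMap {G H : ℝ → ℝ} (hG : ContDiff ℝ 1 G) (hH : ContDiff ℝ 1 H)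
    (hG0 : ∀ s, 0 < G s) {φ : ℝ × ℝ → ℝ} (hφ : ContDiff ℝ 1 φ) (z w : ℝ × ℝ) :
    fderiv ℝ (fun x => φ (cellMap G H x)) z w =
      fderiv ℝ φ (cellMap G H z) (cellMapFDeriv G H z w) := by
  have h := ((hφ.differentiable one_ne_zero (cellMap G H z)).hasFDerivAt).comp z
    (hasFDerivAt_cellMap hG hH hG0 z)
  exact congrArg (· w) h.fderiv

lemma fderiv_fst_comp_mul {b : ℝ → ℝ} (hb : ContDiff ℝ 1 b) {φ : ℝ × ℝ → ℝ}
    (hφ : ContDiff ℝ 1 φ) (z w : ℝ × ℝ) :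
    fderiv ℝ (fun x => b x.1 * φ x) z w =
      b z.1 * fderiv ℝ φ z w + deriv b z.1 * w.1 * φ z := by
  have h1 := (hb.differentiable one_ne_zero z.1).hasDerivAt.comp_hasFDerivAt z
    (hasFDerivAt_fst (𝕜 := ℝ) (p := z))
  have h2 := h1.mul (hφ.differentiable one_ne_zero z).hasFDerivAt
  have h3 := congrArg (· w) h2.fderiv
  refine h3.trans ?_
  simp
  ring

lemma fderiv_snd_mul {φ : ℝ × ℝ → ℝ} (hφ : ContDiff ℝ 1 φ) (z w : ℝ × ℝ) :
    fderiv ℝ (fun x => x.2 * φ x) z w = z.2 * fderiv ℝ φ z w + w.2 * φ z := by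
  have h2 := (hasFDerivAt_snd (𝕜 := ℝ) (p := z)).mul
    (hφ.differentiable one_ne_zero z).hasFDerivAt
  refine (congrArg (· w) h2.fderiv).trans ?_
  simp
  ring

/-- Admissible test functions: `C¹` functions with compact support in `U`. -/
structure IsTestFunction (U : Set (ℝ × ℝ)) (φ : ℝ × ℝ → ℝ) : Prop where
  contDiff : ContDiff ℝ 1 φ
  compact : HasCompactSupport φ
  subset : tsupport φ ⊆ U

lemma IsTestFunction.mul_left {U : Set (ℝ × ℝ)} {φ a : ℝ × ℝ → ℝ} (hφ : IsTestFunction U φ)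
    (ha : ContDiff ℝ 1 a) : IsTestFunction U fun x => a x * φ x :=
  ⟨ha.mul hφ.contDiff, hφ.compact.mul_left, (tsupport_mul_subset_right).trans hφ.subset⟩

lemma IsTestFunction.comp_cellMap {U V : Set (ℝ × ℝ)} {φ : ℝ × ℝ → ℝ} {G H : ℝ → ℝ}
    (hG : ContDiff ℝ 1 G) (hH : ContDiff ℝ 1 H) (hG0 : ∀ s, 0 < G s) (hH0 : ∀ s, 0 < H s)
    (hφ : IsTestFunction U φ) (hUV : cellMap G H ⁻¹' U ⊆ V) :
    IsTestFunction V fun x => φ (cellMap G H x) := by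
  have hc := (contDiff_cellMap hG hH hG0).continuous
  refine ⟨hφ.contDiff.comp (contDiff_cellMap hG hH hG0), ?_,
    (tsupport_comp_subset_preimage φ hc).trans ((preimage_mono hφ.subset).trans hUV)⟩
  refine HasCompactSupport.intro
    (hφ.compact.isCompact.image (contDiff_cellMap hH hG hH0).continuous) fun x hx => ?_
  refine image_eq_zero_of_notMem_tsupport fun h => hx ?_
  exact ⟨_, h, cellMap_cellMap hG0 hH0 x⟩

lemma IsTestFunction.continuous_fderiv {U : Set (ℝ × ℝ)} {φ : ℝ × ℝ → ℝ}
    (hφ : IsTestFunction U φ) (w : ℝ × ℝ) : Continuous fun x => fderiv ℝ φ x w :=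
  (hφ.contDiff.continuous_fderiv one_ne_zero).clm_apply continuous_const

lemma IsTestFunction.compact_fderiv {U : Set (ℝ × ℝ)} {φ : ℝ × ℝ → ℝ}
    (hφ : IsTestFunction U φ) (w : ℝ × ℝ) : HasCompactSupport fun x => fderiv ℝ φ x w :=
  hφ.compact.fderiv_apply ℝ w

lemma integrable_mul_of_hasCompactSupport {X : Type*} [TopologicalSpace X] [MeasurableSpace X]
    [OpensMeasurableSpace X] {μ : Measure X} {u φ : X → ℝ} (hu : Integrable u μ)
    (hφ : Continuous φ) (hc : HasCompactSupport φ) : Integrable (fun x => u x * φ x) μ := by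
  obtain ⟨C, hC⟩ := hφ.bounded_above_of_compact_support hc
  exact hu.mul_bdd (c := C) hφ.aestronglyMeasurable (Eventually.of_forall hC)

lemma integrableOn_fst_mul {L : ℝ} {G c : ℝ → ℝ} {f : ℝ × ℝ → ℝ} (hG : Continuous G)
    (hc : Continuous c) (hf : IntegrableOn f (basicCell L G)) :
    IntegrableOn (fun y => c y.1 * f y) (basicCell L G) := by
  obtain ⟨C, hC⟩ := isCompact_Icc.exists_bound_of_continuousOn (s := Icc 0 L) hc.continuousOn
  refine Integrable.bdd_mul (c := C) hf (hc.comp continuous_fst).aestronglyMeasurable ?_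
  filter_upwards [ae_restrict_mem (isOpen_basicCell hG).measurableSet] with y hy
  exact hC _ ⟨hy.1.le, hy.2.1.le⟩

/-- A weak vertical derivative may be tested with `b(y₁) χ(y)`, where `b` is merely continuous and
`χ` need not vanish near the lateral sides. -/
lemma setIntegral_mul_fderiv_snd_of_strip {L : ℝ} {G : ℝ → ℝ} (hG : Continuous G)
    {u w : ℝ × ℝ → ℝ} (hu : IntegrableOn u (basicCell L G)) (hw : IntegrableOn w (basicCell L G))
    (h : ∀ φ, IsTestFunction (basicCell L G) φ →
      ∫ y in basicCell L G, u y * fderiv ℝ φ y (0, 1) = -∫ y in basicCell L G, w y * φ y)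
    {χ : ℝ × ℝ → ℝ} (hχ : IsTestFunction (cellStrip G) χ) {b : ℝ → ℝ} (hb : Continuous b) :
    ∫ y in basicCell L G, u y * (b y.1 * fderiv ℝ χ y (0, 1)) =
      -∫ y in basicCell L G, w y * (b y.1 * χ y) := by
  have hmeas : MeasurableSet (basicCell L G) := (isOpen_basicCell hG).measurableSet
  have hi1 : IntegrableOn (fun y => u y * fderiv ℝ χ y (0, 1)) (basicCell L G) :=
    integrable_mul_of_hasCompactSupport hu (hχ.continuous_fderiv _) (hχ.compact_fderiv _)
  have hi2 : IntegrableOn (fun y => w y * χ y) (basicCell L G) :=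
    integrable_mul_of_hasCompactSupport hw hχ.contDiff.continuous hχ.compact
  set f : ℝ × ℝ → ℝ := (basicCell L G).indicator fun y => u y * fderiv ℝ χ y (0, 1) + w y * χ y
    with hf
  set F : ℝ → ℝ := fun x => ∫ t, f (x, t) with hF
  have hfi : Integrable f := (hi1.add hi2).integrable_indicator hmeas
  have hFi : Integrable F := by
    rw [Measure.volume_eq_prod] at hfi
    exact hfi.integral_prod_left
  have key : ∀ c : ℝ → ℝ, Continuous c →
      ∫ x, c x * F x = (∫ y in basicCell L G, u y * (c y.1 * fderiv ℝ χ y (0, 1))) +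
        ∫ y in basicCell L G, w y * (c y.1 * χ y) := by
    intro c hc
    have h1 := integrableOn_fst_mul hG hc hi1
    have h2 := integrableOn_fst_mul hG hc hi2
    have h3 : Integrable fun y : ℝ × ℝ => c y.1 * f y := by
      have := (h1.add h2).integrable_indicator hmeas
      refine this.congr (Eventually.of_forall fun y => ?_)
      by_cases hy : y ∈ basicCell L G <;> simp [hf, hy, mul_add]
    have h4 : ∫ y : ℝ × ℝ, c y.1 * f y = ∫ x, c x * F x := by
      rw [Measure.volume_eq_prod] at h3 ⊢
      rw [integral_prod _ h3]
      simp [hF, integral_const_mul]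
    rw [← h4]
    have h5 : (fun y : ℝ × ℝ => c y.1 * f y) = (basicCell L G).indicator
        fun y => c y.1 * (u y * fderiv ℝ χ y (0, 1)) + c y.1 * (w y * χ y) := by
      ext y
      by_cases hy : y ∈ basicCell L G <;> simp [hf, hy, mul_add]
    rw [h5, integral_indicator hmeas, integral_add h1 h2]
    congr 2 <;> ext y <;> ring
  have hF0 : ∀ᵐ x, F x = 0 := by
    have h1 := (isOpen_Ioo (a := (0 : ℝ)) (b := L)).ae_eq_zero_of_integral_contDiff_smul_eq_zero
      (μ := volume) (f := F) (hFi.locallyIntegrable.locallyIntegrableOn _) (fun θ hθ hθc hθs => by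
        have hθ1 : ContDiff ℝ 1 θ := hθ.of_le (by exact_mod_cast le_top)
        simp_rw [smul_eq_mul]
        rw [key θ hθ.continuous]
        have ht : IsTestFunction (basicCell L G) fun y => θ y.1 * χ y := by
          have := hχ.mul_left (hθ1.comp contDiff_fst)
          refine ⟨this.contDiff, this.compact, fun y hy => ?_⟩
          have ha : y ∈ tsupport fun y : ℝ × ℝ => θ y.1 := tsupport_mul_subset_left hy
          have hb := hθs (tsupport_comp_subset_preimage θ continuous_fst ha)
          exact ⟨hb.1, hb.2, this.subset hy⟩
        have := h _ ht
        simp_rw [fderiv_fst_comp_mul hθ1 hχ.contDiff] at this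
        simp only [mul_zero, zero_mul, add_zero] at this
        rw [this]
        ring)
    filter_upwards [h1] with x hx
    by_cases hxL : x ∈ Ioo 0 L
    · exact hx hxL
    · have : ∀ t, f (x, t) = 0 := fun t =>
        indicator_of_notMem (fun hy => hxL ⟨hy.1, hy.2.1⟩) _
      simp [hF, this]
  have h0 : ∫ x, b x * F x = 0 :=
    integral_eq_zero_of_ae (hF0.mono fun x hx => by simp [hx])
  rw [key b hb] at h0
  linarith

lemma transport_fderiv_snd {L : ℝ} {G H : ℝ → ℝ} (hG : ContDiff ℝ 1 G)
    (hH : ContDiff ℝ 1 H) (hG0 : ∀ s, 0 < G s) (hH0 : ∀ s, 0 < H s) {u w : ℝ × ℝ → ℝ}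
    (h : ∀ φ, IsTestFunction (basicCell L H) φ →
      ∫ y in basicCell L H, u y * fderiv ℝ φ y (0, 1) = -∫ y in basicCell L H, w y * φ y)
    {φ : ℝ × ℝ → ℝ} (hφ : IsTestFunction (basicCell L G) φ) :
    ∫ z in basicCell L G, u (cellMap G H z) * fderiv ℝ φ z (0, 1) =
      -∫ z in basicCell L G, H z.1 / G z.1 * w (cellMap G H z) * φ z := by
  have h1 := h _ (hφ.comp_cellMap hH hG hH0 hG0 fun x hx => (cellMap_mem_basicCell hH0 hG0).1 hx)
  simp_rw [fderiv_comp_cellMap hH hG hH0 hφ.contDiff, cellMapFDeriv_apply] at h1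
  rw [setIntegral_basicCell_comp hG hH hG0 hH0, setIntegral_basicCell_comp hG hH hG0 hH0] at h1
  simp_rw [cellMap_cellMap hG0 hH0] at h1
  convert h1 using 2
  · ext z
    have e : ((0 : ℝ), deriv (fun s => G s / H s) (cellMap G H z).1 * (cellMap G H z).2 * 0 +
        G (cellMap G H z).1 / H (cellMap G H z).1 * 1) = (G z.1 / H z.1) • ((0 : ℝ), (1 : ℝ)) := by
      ext <;> simp [cellMap]
    rw [e, map_smul, smul_eq_mul]
    have := (hG0 z.1).ne'
    have := (hH0 z.1).ne'
    field_simp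
  · congr 1
    ext z
    ring

lemma deriv_div_profile_inv {G H : ℝ → ℝ} (hG : ContDiff ℝ 1 G)
    (hH : ContDiff ℝ 1 H) (hG0 : ∀ s, 0 < G s) (hH0 : ∀ s, 0 < H s) (s : ℝ) :
    deriv (fun s => G s / H s) s = -(deriv (fun s => H s / G s) s) * (G s / H s) ^ 2 := by
  have h : (fun s => G s / H s) = fun s => (H s / G s)⁻¹ := by
    ext s
    rw [inv_div]
  rw [h, deriv_fun_inv'' ((contDiff_div_profile hG hH hG0).differentiable one_ne_zero s)
    (div_pos (hH0 s) (hG0 s)).ne']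
  have := (hG0 s).ne'
  have := (hH0 s).ne'
  field_simp

lemma transport_fderiv_fst {L : ℝ} {G H : ℝ → ℝ} (hG : ContDiff ℝ 1 G)
    (hH : ContDiff ℝ 1 H) (hG0 : ∀ s, 0 < G s) (hH0 : ∀ s, 0 < H s) {u w₁ w₂ : ℝ × ℝ → ℝ}
    (hu : IntegrableOn (fun z => u (cellMap G H z)) (basicCell L G))
    (hw₁ : IntegrableOn (fun z => w₁ (cellMap G H z)) (basicCell L G))
    (hw₂ : IntegrableOn (fun z => H z.1 / G z.1 * w₂ (cellMap G H z)) (basicCell L G))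
    (h : ∀ φ, IsTestFunction (basicCell L H) φ →
      ∫ y in basicCell L H, u y * fderiv ℝ φ y (0, 1) = -∫ y in basicCell L H, w₂ y * φ y)
    {φ : ℝ × ℝ → ℝ} (hφ : IsTestFunction (cellStrip G) φ) :
    ∫ z in basicCell L G, (u (cellMap G H z) * fderiv ℝ φ z (1, 0) +
      (w₁ (cellMap G H z) + deriv (fun s => H s / G s) z.1 * z.2 * w₂ (cellMap G H z)) * φ z) =
    ∫ x in basicCell L H,
      (u x * fderiv ℝ (fun x => G x.1 / H x.1 * φ (cellMap H G x)) x (1, 0) +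
        w₁ x * (G x.1 / H x.1 * φ (cellMap H G x))) := by
  have hr := contDiff_div_profile hG hH hG0
  have hρ := contDiff_div_profile hH hG hH0
  have hdr : Continuous (deriv fun s => H s / G s) := hr.continuous_deriv le_rfl
  have hχ : IsTestFunction (cellStrip G) fun y => y.2 * φ y := hφ.mul_left contDiff_snd
  have hb : Continuous fun s => deriv (fun s => H s / G s) s * (G s / H s) :=
    hdr.mul hρ.continuous
  have key := setIntegral_mul_fderiv_snd_of_strip hG.continuous hu hw₂
    (fun ψ hψ => transport_fderiv_snd hG hH hG0 hH0 h hψ) hχ hb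
  have hψ : ContDiff ℝ 1 fun x => φ (cellMap H G x) :=
    hφ.contDiff.comp (contDiff_cellMap hH hG hH0)
  simp_rw [fderiv_fst_comp_mul hρ hψ, fderiv_comp_cellMap hH hG hH0 hφ.contDiff,
    cellMapFDeriv_apply]
  rw [setIntegral_basicCell_comp hG hH hG0 hH0]
  simp_rw [cellMap_cellMap hG0 hH0]
  have j1 : IntegrableOn (fun z => u (cellMap G H z) * fderiv ℝ φ z (1, 0)) (basicCell L G) :=
    integrable_mul_of_hasCompactSupport hu (hφ.continuous_fderiv _) (hφ.compact_fderiv _)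
  have j2 : IntegrableOn (fun z => w₁ (cellMap G H z) * φ z) (basicCell L G) :=
    integrable_mul_of_hasCompactSupport hw₁ hφ.contDiff.continuous hφ.compact
  have j3 : IntegrableOn (fun z => H z.1 / G z.1 * w₂ (cellMap G H z) *
      ((deriv (fun s => H s / G s) z.1 * (G z.1 / H z.1)) * (z.2 * φ z))) (basicCell L G) :=
    (integrableOn_fst_mul hG.continuous hb (integrable_mul_of_hasCompactSupport hw₂ hχ.contDiff.continuous
      hχ.compact)).congr (Eventually.of_forall fun z => by ring)
  have j4 : IntegrableOn (fun z => u (cellMap G H z) *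
      ((deriv (fun s => H s / G s) z.1 * (G z.1 / H z.1)) *
        fderiv ℝ (fun y => y.2 * φ y) z (0, 1))) (basicCell L G) :=
    (integrableOn_fst_mul hG.continuous hb (integrable_mul_of_hasCompactSupport hu (hχ.continuous_fderiv (0, 1))
      (hχ.compact_fderiv _))).congr (Eventually.of_forall fun z => by ring)
  have j12 : IntegrableOn (fun z => u (cellMap G H z) * fderiv ℝ φ z (1, 0) +
      w₁ (cellMap G H z) * φ z) (basicCell L G) := j1.add j2
  have e1 : ∀ z : ℝ × ℝ, (u (cellMap G H z) * fderiv ℝ φ z (1, 0) +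
      (w₁ (cellMap G H z) + deriv (fun s => H s / G s) z.1 * z.2 * w₂ (cellMap G H z)) * φ z) =
      (u (cellMap G H z) * fderiv ℝ φ z (1, 0) + w₁ (cellMap G H z) * φ z) +
      H z.1 / G z.1 * w₂ (cellMap G H z) *
      ((deriv (fun s => H s / G s) z.1 * (G z.1 / H z.1)) * (z.2 * φ z)) := by
    intro z
    have := (hG0 z.1).ne'
    have := (hH0 z.1).ne'
    field_simp
    ring
  simp_rw [e1]
  rw [integral_add j12 j3, ← neg_neg (∫ y in basicCell L G, H y.1 / G y.1 * _ * _), ← key,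
    ← sub_eq_add_neg, ← integral_sub j12 j4]
  congr 1
  ext z
  have e : ((1 : ℝ), deriv (fun s => G s / H s) (cellMap G H z).1 * (cellMap G H z).2 * 1 +
      G (cellMap G H z).1 / H (cellMap G H z).1 * 0) = ((1 : ℝ), (0 : ℝ)) +
      (deriv (fun s => G s / H s) z.1 * (H z.1 / G z.1 * z.2)) • ((0 : ℝ), (1 : ℝ)) := by
    ext <;> simp [cellMap]
  rw [e, map_add, map_smul, fderiv_snd_mul hφ.contDiff]
  simp only [cellMap, smul_eq_mul, deriv_div_profile_inv hG hH hG0 hH0]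
  have := (hG0 z.1).ne'
  have := (hH0 z.1).ne'
  field_simp
  ring

end WeakDerivatives

section Monotonicity

lemma norm_pFlux {p : ℝ} (hp : 1 < p) (s : EuclideanSpace ℝ (Fin 2)) :
    ‖pFlux p s‖ = ‖s‖ ^ (p - 1) := by
  rw [pFlux, norm_smul, Real.norm_of_nonneg (by positivity)]
  rcases (norm_nonneg s).eq_or_lt with h | h
  · rw [← h, mul_zero, Real.zero_rpow (by linarith)]
  · nth_rewrite 2 [← Real.rpow_one ‖s‖]
    rw [← Real.rpow_add h]
    ring_nf

lemma inner_pFlux_self {p : ℝ} (hp : 1 < p) (s : EuclideanSpace ℝ (Fin 2)) :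
    inner ℝ (pFlux p s) s = ‖s‖ ^ p := by
  rw [pFlux, real_inner_smul_left, real_inner_self_eq_norm_sq]
  rcases (norm_nonneg s).eq_or_lt with h | h
  · rw [← h, Real.zero_rpow (by linarith : p ≠ 0)]
    simp
  · rw [← Real.rpow_natCast, ← Real.rpow_add h]
    norm_num

lemma continuous_pFlux {p : ℝ} (hp : 1 < p) : Continuous (pFlux p) := by
  refine continuous_iff_continuousAt.2 fun s => ?_
  by_cases hs : s = 0
  · subst hs
    have h0 : pFlux p 0 = 0 := by simp [pFlux]
    rw [ContinuousAt, h0, tendsto_zero_iff_norm_tendsto_zero]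
    simp_rw [norm_pFlux hp]
    have : Continuous fun s : EuclideanSpace ℝ (Fin 2) => ‖s‖ ^ (p - 1) :=
      continuous_norm.rpow_const fun _ => Or.inr (by linarith)
    simpa [Real.zero_rpow (by linarith : p - 1 ≠ 0)] using this.tendsto 0
  · exact (continuousAt_id.norm.rpow_const (Or.inl (norm_ne_zero_iff.2 hs))).smul continuousAt_id

lemma pFlux_smul {p c : ℝ} (hc : 0 < c) (s : EuclideanSpace ℝ (Fin 2)) :
    pFlux p (c • s) = c ^ (p - 1) • pFlux p s := by
  rw [pFlux, pFlux, norm_smul, Real.norm_of_nonneg hc.le, Real.mul_rpow hc.le (norm_nonneg _),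
    smul_smul, smul_smul]
  congr 1
  have : c ^ (p - 1) = c ^ (p - 2) * c := by
    nth_rewrite 3 [← Real.rpow_one c]
    rw [← Real.rpow_add hc]
    ring_nf
  rw [this]
  ring

lemma mul_rpow_sub_one {p x : ℝ} (hp : 1 < p) (hx : 0 ≤ x) : x ^ (p - 1) * x = x ^ p := by
  rcases hx.eq_or_lt with h | h
  · rw [← h, mul_zero, Real.zero_rpow (by linarith)]
  · nth_rewrite 2 [← Real.rpow_one x]
    rw [← Real.rpow_add h]
    ring_nf

lemma inner_pFlux_sub_aux {p : ℝ} (hp : 1 < p) (a b : EuclideanSpace ℝ (Fin 2)) :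
    0 ≤ (‖a‖ ^ (p - 1) - ‖b‖ ^ (p - 1)) * (‖a‖ - ‖b‖) ∧
    inner ℝ (pFlux p a) (a - b) - inner ℝ (pFlux p b) (a - b) =
      (‖a‖ ^ (p - 1) - ‖b‖ ^ (p - 1)) * (‖a‖ - ‖b‖) +
        (‖a‖ ^ (p - 1) * ‖b‖ - inner ℝ (pFlux p a) b) +
        (‖b‖ ^ (p - 1) * ‖a‖ - inner ℝ (pFlux p b) a) := by
  constructor
  · rcases le_total ‖a‖ ‖b‖ with h | h
    · exact mul_nonneg_of_nonpos_of_nonpos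
        (sub_nonpos.2 (Real.rpow_le_rpow (norm_nonneg _) h (by linarith))) (sub_nonpos.2 h)
    · exact mul_nonneg
        (sub_nonneg.2 (Real.rpow_le_rpow (norm_nonneg _) h (by linarith))) (sub_nonneg.2 h)
  · rw [inner_sub_right, inner_sub_right, inner_pFlux_self hp, inner_pFlux_self hp,
      ← mul_rpow_sub_one hp (norm_nonneg a), ← mul_rpow_sub_one hp (norm_nonneg b)]
    ring

lemma inner_pFlux_le {p : ℝ} (hp : 1 < p) (a b : EuclideanSpace ℝ (Fin 2)) :
    inner ℝ (pFlux p a) b ≤ ‖a‖ ^ (p - 1) * ‖b‖ :=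
  (real_inner_le_norm _ _).trans_eq (by rw [norm_pFlux hp])

lemma inner_pFlux_sub_nonneg {p : ℝ} (hp : 1 < p) (a b : EuclideanSpace ℝ (Fin 2)) :
    0 ≤ inner ℝ (pFlux p a) (a - b) - inner ℝ (pFlux p b) (a - b) := by
  obtain ⟨h1, h2⟩ := inner_pFlux_sub_aux hp a b
  have h3 := inner_pFlux_le hp a b
  have h4 := inner_pFlux_le hp b a
  linarith

lemma eq_of_inner_pFlux_sub_eq_zero {p : ℝ} (hp : 1 < p) {a b : EuclideanSpace ℝ (Fin 2)}
    (h : inner ℝ (pFlux p a) (a - b) - inner ℝ (pFlux p b) (a - b) = 0) : a = b := by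
  obtain ⟨h1, h2⟩ := inner_pFlux_sub_aux hp a b
  have h3 := inner_pFlux_le hp a b
  have h4 := inner_pFlux_le hp b a
  have h5 : (‖a‖ ^ (p - 1) - ‖b‖ ^ (p - 1)) * (‖a‖ - ‖b‖) = 0 := by linarith
  have h6 : inner ℝ (pFlux p a) b = ‖a‖ ^ (p - 1) * ‖b‖ := by linarith
  have hn : ‖a‖ = ‖b‖ := by
    rcases mul_eq_zero.1 h5 with h7 | h7
    · exact (Real.rpow_left_inj (norm_nonneg _) (norm_nonneg _) (by linarith)).1
        (sub_eq_zero.1 h7)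
    · exact sub_eq_zero.1 h7
  by_cases ha : a = 0
  · rw [ha, norm_zero] at hn
    rw [ha, norm_eq_zero.1 hn.symm]
  have ha' : 0 < ‖a‖ := norm_pos_iff.2 ha
  have h8 : inner ℝ a b = ‖a‖ * ‖b‖ := by
    rw [pFlux, real_inner_smul_left] at h6
    have e : ‖a‖ ^ (p - 1) = ‖a‖ ^ (p - 2) * ‖a‖ := by
      nth_rewrite 3 [← Real.rpow_one ‖a‖]
      rw [← Real.rpow_add ha']
      ring_nf
    rw [e, mul_assoc] at h6
    exact mul_left_cancel₀ (Real.rpow_pos_of_pos ha' _).ne' h6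
  have h9 := (inner_eq_norm_mul_iff_real).1 h8
  rw [← hn] at h9
  exact (smul_right_injective _ ha'.ne' h9)

/-- The transposed Jacobian `(k₀ + σ k₁, r k₁)` that transports gradients. -/
noncomputable def gradMap (r σ : ℝ) (k : EuclideanSpace ℝ (Fin 2)) : EuclideanSpace ℝ (Fin 2) :=
  !₂[k 0 + σ * k 1, r * k 1]

lemma gradMap_one_zero (k : EuclideanSpace ℝ (Fin 2)) : gradMap 1 0 k = k := by
  ext i
  fin_cases i <;> simp [gradMap]

lemma gradMap_smul (r σ c : ℝ) (k : EuclideanSpace ℝ (Fin 2)) :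
    gradMap r σ (c • k) = c • gradMap r σ k := by
  ext i
  fin_cases i <;> simp [gradMap] <;> ring

lemma gradMap_sub (r σ : ℝ) (k l : EuclideanSpace ℝ (Fin 2)) :
    gradMap r σ (k - l) = gradMap r σ k - gradMap r σ l := by
  ext i
  fin_cases i <;> simp [gradMap] <;> ring

lemma continuous_gradMap :
    Continuous fun x : (ℝ × ℝ) × EuclideanSpace ℝ (Fin 2) => gradMap x.1.1 x.1.2 x.2 := by
  refine (PiLp.continuous_toLp 2 _).comp (continuous_pi fun i => ?_)
  fin_cases i <;> simp <;> fun_prop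

/-- The difference of the two weak formulations, tested with the difference of the solutions. -/
noncomputable def energyGap (p r σ : ℝ) (k b : EuclideanSpace ℝ (Fin 2)) : ℝ :=
  r * inner ℝ (pFlux p k) (k - gradMap r⁻¹ (-σ / r) b) - inner ℝ (pFlux p b) (gradMap r σ k - b)

/-- The error quantity controlled by `energyGap`. -/
noncomputable def solutionError (p r σ : ℝ) (k b : EuclideanSpace ℝ (Fin 2)) : ℝ :=
  ‖gradMap r σ k - b‖ ^ p + |r * ‖k‖ ^ p - ‖b‖ ^ p|

lemma exists_solutionError_lt_at_identity {p η : ℝ} (hp : 1 < p) (hη : 0 < η) :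
    ∃ C : ℝ, ∀ x ∈ Metric.sphere (0 : EuclideanSpace ℝ (Fin 2) × EuclideanSpace ℝ (Fin 2)) 1,
      solutionError p 1 0 x.1 x.2 <
        η * (1 * ‖x.1‖ ^ p + ‖x.2‖ ^ p) + C * energyGap p 1 0 x.1 x.2 := by
  have hp0 : 0 < p := by linarith
  have hA := continuous_pFlux hp
  have hgap : ∀ k b, energyGap p 1 0 k b =
      inner ℝ (pFlux p k) (k - b) - inner ℝ (pFlux p b) (k - b) := fun k b => by
    simp [energyGap, gradMap_one_zero]
  have hrp : Continuous fun s : ℝ => s ^ p := Real.continuous_rpow_const hp0.le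
  have hgc : Continuous fun x : EuclideanSpace ℝ (Fin 2) × EuclideanSpace ℝ (Fin 2) =>
      energyGap p 1 0 x.1 x.2 := by
    simp_rw [hgap]
    fun_prop
  have hec : Continuous fun x : EuclideanSpace ℝ (Fin 2) × EuclideanSpace ℝ (Fin 2) =>
      solutionError p 1 0 x.1 x.2 := by
    simp_rw [solutionError, gradMap_one_zero]
    exact (hrp.comp (by fun_prop)).add
      ((continuous_const.mul (hrp.comp (by fun_prop))).sub (hrp.comp (by fun_prop))).abs
  have hsc : Continuous fun x : EuclideanSpace ℝ (Fin 2) × EuclideanSpace ℝ (Fin 2) =>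
      η * (1 * ‖x.1‖ ^ p + ‖x.2‖ ^ p) :=
    continuous_const.mul ((continuous_const.mul (hrp.comp (by fun_prop))).add
      (hrp.comp (by fun_prop)))
  have hpos : ∀ x ∈ Metric.sphere (0 : EuclideanSpace ℝ (Fin 2) × EuclideanSpace ℝ (Fin 2)) 1,
      0 < η * (1 * ‖x.1‖ ^ p + ‖x.2‖ ^ p) := by
    intro x hx
    refine mul_pos hη ?_
    by_cases h1 : x.1 = 0
    · have h2 : x.2 ≠ 0 := fun h2 => by
        have : x = 0 := Prod.ext h1 h2
        simp [this] at hx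
      have := Real.rpow_pos_of_pos (norm_pos_iff.2 h2) p
      positivity
    · have := Real.rpow_pos_of_pos (norm_pos_iff.2 h1) p
      positivity
  have hnn : ∀ k b, 0 ≤ energyGap p 1 0 k b := fun k b => by
    rw [hgap]
    exact inner_pFlux_sub_nonneg hp k b
  set K := Metric.sphere (0 : EuclideanSpace ℝ (Fin 2) × EuclideanSpace ℝ (Fin 2)) 1 ∩
    {x | η * (1 * ‖x.1‖ ^ p + ‖x.2‖ ^ p) ≤ solutionError p 1 0 x.1 x.2} with hK
  have hKc : IsCompact K := (isCompact_sphere _ _).inter_right (isClosed_le hsc hec)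
  have hgp : ∀ x ∈ K, energyGap p 1 0 x.1 x.2 ≠ 0 := by
    intro x hx h0
    rw [hgap] at h0
    have hab := eq_of_inner_pFlux_sub_eq_zero hp h0
    have h1 := hpos x hx.1
    have h2 : η * (1 * ‖x.1‖ ^ p + ‖x.2‖ ^ p) ≤ solutionError p 1 0 x.1 x.2 := hx.2
    have h3 : solutionError p 1 0 x.1 x.2 = 0 := by
      simp [solutionError, gradMap_one_zero, hab, Real.zero_rpow hp0.ne']
    linarith
  obtain ⟨C, hC⟩ := hKc.exists_bound_of_continuousOn
    (f := fun x => solutionError p 1 0 x.1 x.2 / energyGap p 1 0 x.1 x.2)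
    (hec.continuousOn.div hgc.continuousOn hgp)
  refine ⟨|C|, fun x hx => ?_⟩
  by_cases hxK : x ∈ K
  · have h1 := (le_abs_self _).trans ((hC x hxK).trans (le_abs_self C))
    have h2 := lt_of_le_of_ne (hnn x.1 x.2) (hgp x hxK).symm
    rw [div_le_iff₀ h2] at h1
    linarith [hpos x hx]
  · have h1 : solutionError p 1 0 x.1 x.2 < η * (1 * ‖x.1‖ ^ p + ‖x.2‖ ^ p) := by
      by_contra h
      exact hxK ⟨hx, not_lt.1 h⟩
    have := mul_nonneg (abs_nonneg C) (hnn x.1 x.2)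
    linarith

lemma exists_solutionError_le {p η : ℝ} (hp : 1 < p) (hη : 0 < η) :
    ∃ τ : ℝ, 0 < τ ∧ ∃ C : ℝ, ∀ r σ : ℝ, |r - 1| < τ → |σ| < τ →
      ∀ k b : EuclideanSpace ℝ (Fin 2),
        solutionError p r σ k b ≤ η * (r * ‖k‖ ^ p + ‖b‖ ^ p) + C * energyGap p r σ k b := by
  have hp0 : 0 < p := by linarith
  have hA := continuous_pFlux hp
  have hrp : Continuous fun s : ℝ => s ^ p := Real.continuous_rpow_const hp0.le
  obtain ⟨C, hC⟩ := exists_solutionError_lt_at_identity hp hη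
  have hev := (isCompact_sphere (0 : EuclideanSpace ℝ (Fin 2) × EuclideanSpace ℝ (Fin 2))
    1).eventually_forall_of_forall_eventually (x₀ := ((1 : ℝ), (0 : ℝ)))
    (P := fun θ x => solutionError p θ.1 θ.2 x.1 x.2 <
      η * (θ.1 * ‖x.1‖ ^ p + ‖x.2‖ ^ p) + C * energyGap p θ.1 θ.2 x.1 x.2) (by
    intro x hx
    have hg1 : Continuous fun y : (ℝ × ℝ) × EuclideanSpace ℝ (Fin 2) × EuclideanSpace ℝ (Fin 2) =>
        gradMap y.1.1 y.1.2 y.2.1 :=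
      continuous_gradMap.comp (continuous_fst.prodMk (continuous_fst.comp continuous_snd))
    have hg2 : ContinuousAt
        (fun y : (ℝ × ℝ) × EuclideanSpace ℝ (Fin 2) × EuclideanSpace ℝ (Fin 2) =>
          gradMap y.1.1⁻¹ (-y.1.2 / y.1.1) y.2.2) (((1 : ℝ), (0 : ℝ)), x) := by
      refine continuous_gradMap.continuousAt.comp
        (f := fun y : (ℝ × ℝ) × EuclideanSpace ℝ (Fin 2) × EuclideanSpace ℝ (Fin 2) =>
          ((y.1.1⁻¹, -y.1.2 / y.1.1), y.2.2)) ?_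
      refine ContinuousAt.prodMk (ContinuousAt.prodMk ?_ ?_) (by fun_prop)
      · exact ContinuousAt.inv₀ (by fun_prop) one_ne_zero
      · exact ContinuousAt.div (by fun_prop) (by fun_prop) one_ne_zero
    refine ContinuousAt.eventually_lt ?_ ?_ (hC x hx)
    · refine Continuous.continuousAt ?_
      exact (hrp.comp (hg1.sub (by fun_prop)).norm).add
        (((continuous_fst.comp continuous_fst).mul (hrp.comp (by fun_prop))).sub
          (hrp.comp (by fun_prop))).abs
    · refine ContinuousAt.add (Continuous.continuousAt ?_) (continuousAt_const.mul ?_)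
      · exact continuous_const.mul
          (((continuous_fst.comp continuous_fst).mul (hrp.comp (by fun_prop))).add
          (hrp.comp (by fun_prop)))
      · refine ContinuousAt.sub (ContinuousAt.mul (by fun_prop) (ContinuousAt.inner ?_ ?_)) ?_
        · exact (hA.comp (by fun_prop)).continuousAt
        · exact ContinuousAt.sub (by fun_prop) hg2
        · exact (Continuous.inner (hA.comp (by fun_prop))
            (hg1.sub (by fun_prop))).continuousAt)
  obtain ⟨τ, hτ, hball⟩ := Metric.eventually_nhds_iff.1 hev
  refine ⟨τ, hτ, C, fun r σ hr hσ k b => ?_⟩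
  have hd : dist (r, σ) ((1 : ℝ), (0 : ℝ)) < τ := by
    rw [Prod.dist_eq, max_lt_iff]
    exact ⟨hr, by simpa [Real.dist_eq] using hσ⟩
  have hθ := hball hd
  by_cases h0 : (k, b) = 0
  · obtain ⟨rfl, rfl⟩ := Prod.mk.inj h0
    have hz : ∀ r σ, gradMap r σ (0 : EuclideanSpace ℝ (Fin 2)) = 0 := fun r σ => by
      ext i
      fin_cases i <;> simp [gradMap]
    simp [solutionError, energyGap, hz, Real.zero_rpow hp0.ne']
  set c := ‖(k, b)‖ with hc
  have hc0 : 0 < c := norm_pos_iff.2 h0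
  have hs : c⁻¹ • (k, b) ∈
      Metric.sphere (0 : EuclideanSpace ℝ (Fin 2) × EuclideanSpace ℝ (Fin 2)) 1 := by
    rw [mem_sphere_zero_iff_norm, norm_smul, norm_inv, norm_norm, inv_mul_cancel₀ hc0.ne']
  have h1 := (hθ _ hs).le
  have hci : 0 < c⁻¹ := inv_pos.2 hc0
  have hcp : 0 < (c⁻¹) ^ p := Real.rpow_pos_of_pos hci p
  have hn : ∀ s : EuclideanSpace ℝ (Fin 2), ‖c⁻¹ • s‖ ^ p = (c⁻¹) ^ p * ‖s‖ ^ p := fun s => by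
    rw [norm_smul, Real.norm_of_nonneg hci.le, Real.mul_rpow hci.le (norm_nonneg _)]
  have hin : ∀ s t : EuclideanSpace ℝ (Fin 2),
      inner ℝ (pFlux p (c⁻¹ • s)) (c⁻¹ • t) = (c⁻¹) ^ p * inner ℝ (pFlux p s) t := fun s t => by
    rw [pFlux_smul hci, real_inner_smul_left, real_inner_smul_right,
      ← mul_rpow_sub_one hp hci.le]
    ring
  have e1 : solutionError p r σ (c⁻¹ • k) (c⁻¹ • b) = (c⁻¹) ^ p * solutionError p r σ k b := by
    rw [solutionError, solutionError, gradMap_smul, ← smul_sub, hn, hn, hn, mul_add,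
      ← abs_of_pos hcp, ← abs_mul, abs_of_pos hcp]
    ring_nf
  have e2 : energyGap p r σ (c⁻¹ • k) (c⁻¹ • b) = (c⁻¹) ^ p * energyGap p r σ k b := by
    rw [energyGap, energyGap, gradMap_smul, gradMap_smul, ← smul_sub, ← smul_sub, hin, hin]
    ring
  simp only [Prod.smul_mk] at h1
  rw [e1, e2, hn, hn] at h1
  refine le_of_mul_le_mul_left ?_ hcp
  linarith

end Monotonicity

section PeriodicSobolev

lemma integrableOn_of_memLp {p L G₀ G₁ M : ℝ} {G : ℝ → ℝ} (hp : 1 < p)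
    (hG : G ∈ AdmissibleProfiles L G₀ G₁ M) {u : ℝ × ℝ → ℝ}
    (hu : MemLp u (ENNReal.ofReal p) (volume.restrict (basicCell L G))) :
    IntegrableOn u (basicCell L G) :=
  have := isFiniteMeasure_restrict_basicCell hG
  hu.integrable (ENNReal.one_le_ofReal.2 hp.le)

lemma memLp_continuous_mul {q : ℝ≥0∞} {L G₀ G₁ M : ℝ} {G : ℝ → ℝ}
    (hG : G ∈ AdmissibleProfiles L G₀ G₁ M) {c u : ℝ × ℝ → ℝ} (hc : Continuous c)
    (hu : MemLp u q (volume.restrict (basicCell L G))) :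
    MemLp (fun z => c z * u z) q (volume.restrict (basicCell L G)) := by
  obtain ⟨C, hC⟩ := (isCompact_Icc.prod isCompact_Icc).exists_bound_of_continuousOn
    (s := Icc 0 L ×ˢ Icc 0 G₁) hc.continuousOn
  refine hu.of_le_mul (c := C) (hc.aestronglyMeasurable.mul hu.1) ?_
  filter_upwards [ae_restrict_mem (isOpen_basicCell hG.1.continuous).measurableSet] with z hz
  rw [norm_mul]
  gcongr
  exact hC _ (basicCell_subset_Icc hG hz)

/-- The gradient of `u ∘ cellMap G H`, where `g` is the gradient of `u`. -/
noncomputable def pullGrad (G H : ℝ → ℝ) (g : ℝ × ℝ → EuclideanSpace ℝ (Fin 2)) (z : ℝ × ℝ) :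
    EuclideanSpace ℝ (Fin 2) :=
  gradMap (H z.1 / G z.1) (deriv (fun s => H s / G s) z.1 * z.2) (g (cellMap G H z))

lemma memLp_pullGrad {p L G₀ G₁ M : ℝ} {G H : ℝ → ℝ} (hp : 1 < p) (hG₀ : 0 < G₀)
    (hG : G ∈ AdmissibleProfiles L G₀ G₁ M) (hH : H ∈ AdmissibleProfiles L G₀ G₁ M)
    {g : ℝ × ℝ → EuclideanSpace ℝ (Fin 2)}
    (hg : MemLp g (ENNReal.ofReal p) (volume.restrict (basicCell L H))) :
    MemLp (pullGrad G H g) (ENNReal.ofReal p) (volume.restrict (basicCell L G)) := by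
  have h := memLp_comp_cellMap hp hG₀ hG hH hg
  have hr := contDiff_div_profile hG.1 hH.1 (AdmissibleProfiles.pos hG₀ hG)
  rw [memLp_piLp_iff] at h ⊢
  intro i
  fin_cases i
  · exact (h 0).add (memLp_continuous_mul (c := fun z => deriv (fun s => H s / G s) z.1 * z.2) hG
      (((hr.continuous_deriv le_rfl).comp continuous_fst).mul continuous_snd) (h 1))
  · exact memLp_continuous_mul hG (hr.continuous.comp continuous_fst) (h 1)

lemma memW1p_comp_cellMap {p L G₀ G₁ M : ℝ} {G H : ℝ → ℝ} (hp : 1 < p) (hG₀ : 0 < G₀)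
    (hG : G ∈ AdmissibleProfiles L G₀ G₁ M) (hH : H ∈ AdmissibleProfiles L G₀ G₁ M)
    {u : ℝ × ℝ → ℝ} {g : ℝ × ℝ → EuclideanSpace ℝ (Fin 2)}
    (h : MemW1p p (basicCell L H) u g) :
    MemW1p p (basicCell L G) (fun z => u (cellMap G H z)) (pullGrad G H g) ∧
    ∀ φ, IsTestFunction (cellStrip G) φ →
    ∫ z in basicCell L G, (u (cellMap G H z) * fderiv ℝ φ z (1, 0) + pullGrad G H g z 0 * φ z) =
    ∫ x in basicCell L H,
      (u x * fderiv ℝ (fun x => G x.1 / H x.1 * φ (cellMap H G x)) x (1, 0) +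
        g x 0 * (G x.1 / H x.1 * φ (cellMap H G x))) := by
  have hG0 := AdmissibleProfiles.pos hG₀ hG
  have hH0 := AdmissibleProfiles.pos hG₀ hH
  have hu := memLp_comp_cellMap hp hG₀ hG hH h.memLp
  have hg := (memLp_piLp_iff.1 (memLp_comp_cellMap hp hG₀ hG hH h.memLp_grad))
  have hpg := memLp_pullGrad hp hG₀ hG hH h.memLp_grad
  have hr := contDiff_div_profile hG.1 hH.1 hG0
  have hρ := contDiff_div_profile hH.1 hG.1 hH0
  have hw2 : ∀ φ, IsTestFunction (basicCell L H) φ →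
      ∫ y in basicCell L H, u y * fderiv ℝ φ y (0, 1) = -∫ y in basicCell L H, g y 1 * φ y :=
    fun φ hφ => (h.weakGrad φ hφ.1 hφ.2 hφ.3).2
  have key : ∀ φ, IsTestFunction (cellStrip G) φ →
    ∫ z in basicCell L G, (u (cellMap G H z) * fderiv ℝ φ z (1, 0) + pullGrad G H g z 0 * φ z) =
    ∫ x in basicCell L H,
      (u x * fderiv ℝ (fun x => G x.1 / H x.1 * φ (cellMap H G x)) x (1, 0) +
        g x 0 * (G x.1 / H x.1 * φ (cellMap H G x))) := by
    intro φ hφ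
    exact transport_fderiv_fst hG.1 hH.1 hG0 hH0 (w₁ := fun x => g x 0) (w₂ := fun x => g x 1)
      (integrableOn_of_memLp hp hG hu) (integrableOn_of_memLp hp hG (hg 0))
      (integrableOn_of_memLp hp hG
        (memLp_continuous_mul hG (hr.continuous.comp continuous_fst) (hg 1))) hw2 hφ
  refine ⟨⟨hu, hpg, fun φ h1 h2 h3 => ⟨?_, ?_⟩⟩, key⟩
  · have hφ : IsTestFunction (cellStrip G) φ := ⟨h1, h2, fun y hy => (h3 hy).2.2⟩
    have e1 := key φ hφ
    have hφ' : IsTestFunction (basicCell L G) φ := ⟨h1, h2, h3⟩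
    have hψ : IsTestFunction (basicCell L H) fun x => G x.1 / H x.1 * φ (cellMap H G x) :=
      (hφ'.comp_cellMap hH.1 hG.1 hH0 hG0
        fun x hx => (cellMap_mem_basicCell hH0 hG0).1 hx).mul_left (hρ.comp contDiff_fst)
    have e2 := (h.weakGrad _ hψ.1 hψ.2 hψ.3).1
    have i1 := integrable_mul_of_hasCompactSupport (integrableOn_of_memLp hp hH h.memLp)
      (hψ.continuous_fderiv (1, 0)) (hψ.compact_fderiv _)
    have i2 := integrable_mul_of_hasCompactSupport
      (integrableOn_of_memLp hp hH (memLp_piLp_iff.1 h.memLp_grad 0)) hψ.1.continuous hψ.2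
    have i3 := integrable_mul_of_hasCompactSupport (integrableOn_of_memLp hp hG hu)
      (hφ.continuous_fderiv (1, 0)) (hφ.compact_fderiv _)
    have i4 := integrable_mul_of_hasCompactSupport
      (integrableOn_of_memLp hp hG (memLp_piLp_iff.1 hpg 0)) hφ.1.continuous hφ.2
    rw [integral_add i1 i2, integral_add i3 i4, e2] at e1
    linarith
  · exact transport_fderiv_snd hG.1 hH.1 hG0 hH0 (w := fun x => g x 1) hw2 ⟨h1, h2, h3⟩

lemma memLp_comp_mul_left {q : ℝ≥0∞} {c a : ℝ} (hc : 0 < c) {w : ℝ → ℝ}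
    (hw : MemLp w q (volume.restrict (Ioo 0 (c * a)))) :
    MemLp (fun t => w (c * t)) q (volume.restrict (Ioo 0 a)) := by
  have he : MeasurableEmbedding fun t : ℝ => c * t :=
    (Homeomorph.mulLeft₀ c hc.ne').measurableEmbedding
  have hpre : (fun t : ℝ => c * t) ⁻¹' Ioo 0 (c * a) = Ioo 0 a := by
    ext t
    simp [hc, mul_div_cancel_left₀ _ hc.ne']
  have h1 : Measure.map (fun t => c * t) (volume.restrict (Ioo 0 a)) =
      ENNReal.ofReal |c⁻¹| • volume.restrict (Ioo 0 (c * a)) := by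
    rw [← hpre, ← he.restrict_map, Real.map_volume_mul_left hc.ne', Measure.restrict_smul]
  have h2 := hw.smul_measure (c := ENNReal.ofReal |c⁻¹|) ENNReal.ofReal_ne_top
  rw [← h1, he.memLp_map_measure_iff] at h2
  exact h2

lemma setIntegral_Ioo_comp_mul_left {c a : ℝ} (hc : 0 < c) (ha : 0 < a) (f : ℝ → ℝ) :
    ∫ t in Ioo 0 (c * a), f t = ∫ t in Ioo 0 a, c * f (c * t) := by
  have := intervalIntegral.mul_integral_comp_mul_left (a := 0) (b := a) (f := f) (c := c)
  rw [mul_zero, intervalIntegral.integral_of_le ha.le,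
    intervalIntegral.integral_of_le (by positivity)] at this
  rw [← integral_Ioc_eq_integral_Ioo, ← integral_Ioc_eq_integral_Ioo, ← this, integral_const_mul]

lemma memW1pPer_comp_cellMap {p L G₀ G₁ M : ℝ} {G H : ℝ → ℝ} (hp : 1 < p) (hG₀ : 0 < G₀)
    (hG : G ∈ AdmissibleProfiles L G₀ G₁ M) (hH : H ∈ AdmissibleProfiles L G₀ G₁ M)
    {u : ℝ × ℝ → ℝ} {g : ℝ × ℝ → EuclideanSpace ℝ (Fin 2)} (h : MemW1pPer p L H u g) :
    MemW1pPer p L G (fun z => u (cellMap G H z)) (pullGrad G H g) := by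
  obtain ⟨h1, w, hw⟩ := h
  obtain ⟨h2, h3⟩ := memW1p_comp_cellMap hp hG₀ hG hH h1
  have hG0 := AdmissibleProfiles.pos hG₀ hG
  have hH0 := AdmissibleProfiles.pos hG₀ hH
  have hGL : G L = G 0 := by simpa using hG.2.1 0
  have hHL : H L = H 0 := by simpa using hH.2.1 0
  have hc : 0 < H 0 / G 0 := div_pos (hH0 0) (hG0 0)
  have e0 : H 0 = H 0 / G 0 * G 0 := by have := (hG0 0).ne'; field_simp
  have hm : MemLp (fun t => w (H 0 / G 0 * t)) (ENNReal.ofReal p)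
      (volume.restrict (Ioo 0 (G 0))) :=
    memLp_comp_mul_left hc (by rw [← e0]; exact hw.memLp_left)
  refine ⟨h2, fun t => w (H 0 / G 0 * t), hm, by rw [hGL]; exact hm, fun φ h4 h5 h6 => ?_⟩
  have hφ : IsTestFunction (cellStrip G) φ := ⟨h4, h5, h6⟩
  have hρ := contDiff_div_profile hH.1 hG.1 hH0
  have hψ : IsTestFunction (cellStrip H) fun x => G x.1 / H x.1 * φ (cellMap H G x) :=
    (hφ.comp_cellMap hH.1 hG.1 hH0 hG0
      fun x hx => (cellMap_mem_cellStrip hH0 hG0).1 hx).mul_left (hρ.comp contDiff_fst)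
  rw [h3 φ hφ, hw.green _ hψ.1 hψ.2 hψ.3, hGL, hHL, e0,
    setIntegral_Ioo_comp_mul_left hc (hG0 0), setIntegral_Ioo_comp_mul_left hc (hG0 0), ← e0]
  have := (hG0 0).ne'
  have := (hH0 0).ne'
  congr 2 <;> ext t <;> simp only [cellMap, hGL, hHL] <;> field_simp

lemma MemW1p.integrableOn_mul {p L G₀ G₁ M : ℝ} {G : ℝ → ℝ} (hp : 1 < p)
    (hG : G ∈ AdmissibleProfiles L G₀ G₁ M) {u φ : ℝ × ℝ → ℝ}
    {g : ℝ × ℝ → EuclideanSpace ℝ (Fin 2)} (h : MemW1p p (basicCell L G) u g)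
    (hφ : ContDiff ℝ 1 φ) (hφc : HasCompactSupport φ) :
    (∀ w, IntegrableOn (fun y => u y * fderiv ℝ φ y w) (basicCell L G)) ∧
      ∀ i, IntegrableOn (fun y => g y i * φ y) (basicCell L G) := by
  have hφ' : IsTestFunction univ φ := ⟨hφ, hφc, subset_univ _⟩
  exact ⟨fun w => integrable_mul_of_hasCompactSupport (integrableOn_of_memLp hp hG h.memLp)
    (hφ'.continuous_fderiv w) (hφ'.compact_fderiv w), fun i =>
    integrable_mul_of_hasCompactSupport (integrableOn_of_memLp hp hG
      (memLp_piLp_iff.1 h.memLp_grad i)) hφ.continuous hφc⟩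

lemma MemW1p.sub {p L G₀ G₁ M : ℝ} {G : ℝ → ℝ} (hp : 1 < p)
    (hG : G ∈ AdmissibleProfiles L G₀ G₁ M)
    {u₁ u₂ : ℝ × ℝ → ℝ} {g₁ g₂ : ℝ × ℝ → EuclideanSpace ℝ (Fin 2)}
    (h₁ : MemW1p p (basicCell L G) u₁ g₁) (h₂ : MemW1p p (basicCell L G) u₂ g₂) :
    MemW1p p (basicCell L G) (fun y => u₁ y - u₂ y) (fun y => g₁ y - g₂ y) := by
  refine ⟨h₁.memLp.sub h₂.memLp, h₁.memLp_grad.sub h₂.memLp_grad, fun φ b₁ b₂ b₃ => ?_⟩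
  obtain ⟨i1, i2⟩ := h₁.integrableOn_mul hp hG b₁ b₂
  obtain ⟨j1, j2⟩ := h₂.integrableOn_mul hp hG b₁ b₂
  obtain ⟨c1, c2⟩ := h₁.weakGrad φ b₁ b₂ b₃
  obtain ⟨d1, d2⟩ := h₂.weakGrad φ b₁ b₂ b₃
  simp only [sub_mul, PiLp.sub_apply]
  rw [integral_sub (i1 _) (j1 _), integral_sub (i2 _) (j2 _), integral_sub (i1 _) (j1 _),
    integral_sub (i2 _) (j2 _), c1, c2, d1, d2]
  constructor <;> ring

lemma MemW1pPer.sub {p L G₀ G₁ M : ℝ} {G : ℝ → ℝ} (hp : 1 < p)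
    (hG : G ∈ AdmissibleProfiles L G₀ G₁ M)
    {u₁ u₂ : ℝ × ℝ → ℝ} {g₁ g₂ : ℝ × ℝ → EuclideanSpace ℝ (Fin 2)}
    (h₁ : MemW1pPer p L G u₁ g₁) (h₂ : MemW1pPer p L G u₂ g₂) :
    MemW1pPer p L G (fun y => u₁ y - u₂ y) (fun y => g₁ y - g₂ y) := by
  obtain ⟨a₁, w₁, t₁⟩ := h₁
  obtain ⟨a₂, w₂, t₂⟩ := h₂
  have ht : ∀ {w : ℝ → ℝ} {a s : ℝ} {φ : ℝ × ℝ → ℝ},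
      MemLp w (ENNReal.ofReal p) (volume.restrict (Ioo 0 a)) →
      ContDiff ℝ 1 φ → HasCompactSupport φ →
      IntegrableOn (fun t => w t * φ (s, t)) (Ioo 0 a) := by
    intro w a s φ hw hφ hφc
    obtain ⟨C, hC⟩ := hφ.continuous.bounded_above_of_compact_support hφc
    exact (hw.integrable (ENNReal.one_le_ofReal.2 hp.le)).mul_bdd (c := C)
      (hφ.continuous.comp (Continuous.prodMk_right s)).aestronglyMeasurable
      (Eventually.of_forall fun t => hC _)
  refine ⟨a₁.sub hp hG a₂, fun t => w₁ t - w₂ t, t₁.memLp_left.sub t₂.memLp_left,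
    t₁.memLp_right.sub t₂.memLp_right, fun φ b₁ b₂ b₃ => ?_⟩
  obtain ⟨i1, i2⟩ := a₁.integrableOn_mul hp hG b₁ b₂
  obtain ⟨j1, j2⟩ := a₂.integrableOn_mul hp hG b₁ b₂
  have c := t₁.green φ b₁ b₂ b₃
  have d := t₂.green φ b₁ b₂ b₃
  rw [integral_add (i1 _) (i2 0)] at c
  rw [integral_add (j1 _) (j2 0)] at d
  have i3 : IntegrableOn (fun y => u₁ y * fderiv ℝ φ y (1, 0) - u₂ y * fderiv ℝ φ y (1, 0))
    (basicCell L G) := (i1 _).sub (j1 _)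
  have i4 : IntegrableOn (fun y => g₁ y 0 * φ y - g₂ y 0 * φ y) (basicCell L G) :=
    (i2 0).sub (j2 0)
  simp only [sub_mul, PiLp.sub_apply]
  rw [integral_add i3 i4, integral_sub (i1 _) (j1 _), integral_sub (i2 0) (j2 0),
    integral_sub (ht t₁.memLp_right b₁ b₂) (ht t₂.memLp_right b₁ b₂),
    integral_sub (ht t₁.memLp_left b₁ b₂) (ht t₂.memLp_left b₁ b₂)]
  linarith

lemma IsTestFunction.integral_fderiv_eq_zero {U : Set (ℝ × ℝ)} {φ : ℝ × ℝ → ℝ}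
    (hφ : IsTestFunction U φ) (w : ℝ × ℝ) : ∫ y, fderiv ℝ φ y w = 0 := by
  have h := integral_mul_fderiv_eq_neg_fderiv_mul_of_integrable (μ := (volume : Measure (ℝ × ℝ)))
    (f := fun _ : ℝ × ℝ => (1 : ℝ)) (g := φ) (v := w) (by simp)
    (by simpa using (hφ.continuous_fderiv w).integrable_of_hasCompactSupport (hφ.compact_fderiv w))
    (by simpa using hφ.contDiff.continuous.integrable_of_hasCompactSupport hφ.compact)
    (fun _ _ => differentiableAt_const _) fun x _ => hφ.contDiff.differentiable one_ne_zero x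
  simpa using h

lemma IsTestFunction.setIntegral_fderiv_eq_zero {U : Set (ℝ × ℝ)} {φ : ℝ × ℝ → ℝ}
    (hφ : IsTestFunction U φ) (w : ℝ × ℝ) : ∫ y in U, fderiv ℝ φ y w = 0 := by
  rw [setIntegral_eq_integral_of_forall_compl_eq_zero fun x hx => ?_,
    hφ.integral_fderiv_eq_zero w]
  rw [fderiv_of_notMem_tsupport ℝ fun h => hx (hφ.subset h)]
  rfl

lemma memW1p_const_mul_fst {p L G₀ G₁ M : ℝ} {G : ℝ → ℝ} (hG : G ∈ AdmissibleProfiles L G₀ G₁ M) (c : ℝ) :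
    MemW1p p (basicCell L G) (fun y => c * y.1) (fun _ => !₂[c, 0]) := by
  have := isFiniteMeasure_restrict_basicCell hG
  refine ⟨?_, memLp_const _, fun φ h1 h2 h3 => ?_⟩
  · simpa [mul_comm] using memLp_continuous_mul hG continuous_fst
      (memLp_const (p := ENNReal.ofReal p) c)
  · have hφ : IsTestFunction (basicCell L G) φ := ⟨h1, h2, h3⟩
    have hψ : IsTestFunction (basicCell L G) fun y => y.1 * φ y := hφ.mul_left contDiff_fst
    have e : ∀ w y : ℝ × ℝ, fderiv ℝ (fun y => y.1 * φ y) y w =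
        y.1 * fderiv ℝ φ y w + w.1 * φ y := fun w y => by
      have := fderiv_fst_comp_mul (b := fun s => s) contDiff_id h1 y w
      simpa using this
    have hi : ∀ w, IntegrableOn (fun y : ℝ × ℝ => y.1 * fderiv ℝ φ y w) (basicCell L G) :=
      fun w => ((continuous_fst.mul (hφ.continuous_fderiv w)).integrable_of_hasCompactSupport
        (hφ.compact_fderiv w).mul_left).integrableOn
    have hj : ∀ c : ℝ, IntegrableOn (fun y : ℝ × ℝ => c * φ y) (basicCell L G) := fun c =>
      ((h1.continuous.integrable_of_hasCompactSupport h2).const_mul c).integrableOn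
    have k : ∀ w : ℝ × ℝ, (∫ y in basicCell L G, y.1 * fderiv ℝ φ y w) =
        -∫ y in basicCell L G, w.1 * φ y := fun w => by
      have := hψ.setIntegral_fderiv_eq_zero w
      simp_rw [e] at this
      rw [integral_add (hi w) (hj _)] at this
      linarith
    simp [mul_assoc, integral_const_mul, k]

lemma setIntegral_fderiv_fst_basicCell {L : ℝ} {G : ℝ → ℝ} (hL : 0 < L) (hG : Continuous G)
    {φ : ℝ × ℝ → ℝ} (hφ : IsTestFunction (cellStrip G) φ) :
    ∫ y in basicCell L G, fderiv ℝ φ y (1, 0) =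
      (∫ t in Ioo 0 (G L), φ (L, t)) - ∫ t in Ioo 0 (G 0), φ (0, t) := by
  have hz : ∀ y ∉ cellStrip G, φ y = 0 := fun y hy =>
    image_eq_zero_of_notMem_tsupport fun h => hy (hφ.subset h)
  have hz' : ∀ y ∉ cellStrip G, fderiv ℝ φ y (1, 0) = 0 := fun y hy => by
    rw [fderiv_of_notMem_tsupport ℝ fun h => hy (hφ.subset h)]
    rfl
  have hd := hφ.continuous_fderiv (1, 0)
  have hi : Integrable fun y => fderiv ℝ φ y (1, 0) :=
    hd.integrable_of_hasCompactSupport (hφ.compact_fderiv _)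
  have hslice : ∀ s, ∫ t in Ioo 0 (G s), φ (s, t) = ∫ t, φ (s, t) := fun s =>
    setIntegral_eq_integral_of_forall_compl_eq_zero fun t ht => hz _ fun h => ht ⟨h.1, h.2⟩
  have hint : ∀ s, Integrable fun t => φ (s, t) := fun s =>
    (hφ.contDiff.continuous.comp (Continuous.prodMk_right s)).integrable_of_hasCompactSupport
      (HasCompactSupport.intro (hφ.compact.isCompact.image continuous_snd) fun t ht =>
        image_eq_zero_of_notMem_tsupport (f := φ) fun h => ht ⟨(s, t), h, rfl⟩)
  have h1 : ∫ y in basicCell L G, fderiv ℝ φ y (1, 0) =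
      ∫ y in Ioo 0 L ×ˢ (univ : Set ℝ), fderiv ℝ φ y (1, 0) := by
    have : basicCell L G = (Ioo 0 L ×ˢ (univ : Set ℝ)) ∩ cellStrip G := by
      ext y
      simp [basicCell, cellStrip, and_assoc]
    rw [this, ← setIntegral_indicator (isOpen_cellStrip hG).measurableSet]
    congr 1
    ext y
    by_cases hy : y ∈ cellStrip G <;> simp [hy, hz']
  rw [h1, hslice, hslice, ← integral_sub (hint L) (hint 0)]
  have h2 : (volume.restrict (Ioo 0 L ×ˢ (univ : Set ℝ)) : Measure (ℝ × ℝ)) =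
      (volume.restrict (Ioo 0 L)).prod volume := by
    rw [Measure.volume_eq_prod, ← Measure.prod_restrict, Measure.restrict_univ]
  have hi2 := hi.restrict (s := Ioo 0 L ×ˢ (univ : Set ℝ))
  rw [h2] at hi2 ⊢
  rw [integral_prod_symm _ hi2]
  congr 1
  ext t
  have hder : ∀ x, HasDerivAt (fun s => φ (s, t)) (fderiv ℝ φ (x, t) (1, 0)) x := fun x => by
    have h3 := (hφ.contDiff.differentiable one_ne_zero (x, t)).hasFDerivAt
    have h4 := h3.comp_hasDerivAt x ((hasDerivAt_id x).prodMk (hasDerivAt_const x t))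
    exact h4
  rw [← integral_Ioc_eq_integral_Ioo, ← intervalIntegral.integral_of_le hL.le]
  exact intervalIntegral.integral_eq_sub_of_hasDerivAt (fun x _ => hder x)
    (hd.comp (Continuous.prodMk_left t)).continuousOn.intervalIntegrable

lemma memW1pPer_const {p L G₀ G₁ M : ℝ} {G : ℝ → ℝ} (hL : 0 < L)
    (hG : G ∈ AdmissibleProfiles L G₀ G₁ M) (c : ℝ) :
    MemW1pPer p L G (fun _ => c) (fun _ => 0) := by
  have := isFiniteMeasure_restrict_basicCell hG
  refine ⟨⟨memLp_const _, memLp_const _, fun φ h1 h2 h3 => ?_⟩, fun _ => c, memLp_const _,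
    memLp_const _, fun φ h1 h2 h3 => ?_⟩
  · have hφ : IsTestFunction (basicCell L G) φ := ⟨h1, h2, h3⟩
    simp [integral_const_mul, hφ.setIntegral_fderiv_eq_zero]
  · simp only [PiLp.zero_apply, zero_mul, add_zero, integral_const_mul]
    rw [setIntegral_fderiv_fst_basicCell hL hG.1.continuous ⟨h1, h2, h3⟩]
    ring

/-- The difference of two periodic functions, made of zero average. -/
lemma MemW1pPer.exists_memW1pPerZero_sub {p L G₀ G₁ M : ℝ} {G : ℝ → ℝ} (hp : 1 < p)
    (hL : 0 < L) (hG₀ : 0 < G₀) (hG : G ∈ AdmissibleProfiles L G₀ G₁ M)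
    {u₁ u₂ : ℝ × ℝ → ℝ} {g₁ g₂ : ℝ × ℝ → EuclideanSpace ℝ (Fin 2)}
    (h₁ : MemW1pPer p L G u₁ g₁) (h₂ : MemW1pPer p L G u₂ g₂) :
    ∃ φ, MemW1pPerZero p L G φ (fun y => g₁ y - g₂ y) := by
  have h := MemW1pPer.sub hp hG h₁ h₂
  have := isFiniteMeasure_restrict_basicCell hG
  have hvol : volume.real (basicCell L G) ≠ 0 := by
    have hne : (basicCell L G).Nonempty :=
      ⟨(L / 2, G (L / 2) / 2), by
        have := AdmissibleProfiles.pos hG₀ hG (L / 2)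
        refine ⟨?_, ?_, ?_, ?_⟩ <;> dsimp only <;> linarith⟩
    have h1 := (isOpen_basicCell (L := L) hG.1.continuous).measure_pos volume hne
    have h2 : volume (basicCell L G) ≠ ∞ := by
      rw [← Measure.restrict_apply_univ]
      exact measure_ne_top _ _
    exact (ENNReal.toReal_pos h1.ne' h2).ne'
  set c := (∫ y in basicCell L G, (u₁ y - u₂ y)) / volume.real (basicCell L G) with hc
  refine ⟨fun y => (u₁ y - u₂ y) - c, ?_, ?_⟩
  · simpa using MemW1pPer.sub hp hG h (memW1pPer_const hL hG c)
  · rw [integral_sub (integrableOn_of_memLp hp hG h.1.memLp) (integrable_const c),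
      integral_const, measureReal_restrict_apply_univ, smul_eq_mul, hc]
    field_simp
    ring

end PeriodicSobolev

section Stability

lemma integrable_norm_rpow_of_memLp {X F : Type*} [MeasurableSpace X] [NormedAddCommGroup F]
    {μ : Measure X} {p : ℝ} (hp : 1 < p) {f : X → F} (hf : MemLp f (ENNReal.ofReal p) μ) :
    Integrable (fun x => ‖f x‖ ^ p) μ := by
  have hp0 : 0 < p := by linarith
  have := hf.integrable_norm_rpow (by simpa using hp0) ENNReal.ofReal_ne_top
  rwa [ENNReal.toReal_ofReal hp0.le] at this

lemma integrable_inner_pFlux {X : Type*} [MeasurableSpace X] {μ : Measure X} {p : ℝ} (hp : 1 < p)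
    {a b : X → EuclideanSpace ℝ (Fin 2)} (ha : MemLp a (ENNReal.ofReal p) μ)
    (hb : MemLp b (ENNReal.ofReal p) μ) :
    Integrable (fun x => inner ℝ (pFlux p (a x)) (b x)) μ := by
  have hp0 : 0 < p := by linarith
  refine ((integrable_norm_rpow_of_memLp hp ha).add (integrable_norm_rpow_of_memLp hp hb)).mono'
    (((continuous_pFlux hp).comp_aestronglyMeasurable ha.1).inner hb.1)
    (Eventually.of_forall fun x => ?_)
  refine (norm_inner_le_norm _ _).trans ?_
  rw [norm_pFlux hp]
  have h1 : ‖a x‖ ^ (p - 1) * ‖b x‖ ≤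
      max ‖a x‖ ‖b x‖ ^ (p - 1) * max ‖a x‖ ‖b x‖ :=
    mul_le_mul (Real.rpow_le_rpow (norm_nonneg _) (le_max_left _ _) (by linarith))
      (le_max_right _ _) (norm_nonneg _) (by positivity)
  refine h1.trans ?_
  rw [mul_rpow_sub_one hp (le_max_of_le_left (norm_nonneg _))]
  have := Real.rpow_nonneg (norm_nonneg (a x)) p
  have := Real.rpow_nonneg (norm_nonneg (b x)) p
  rcases max_choice ‖a x‖ ‖b x‖ with h | h <;> rw [h] <;> dsimp only [Pi.add_apply] <;> linarith

lemma IsCellSolution.memLp_grad {p L G₀ G₁ M : ℝ} {G : ℝ → ℝ}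
    (hG : G ∈ AdmissibleProfiles L G₀ G₁ M) {v : ℝ × ℝ → ℝ}
    {g : ℝ × ℝ → EuclideanSpace ℝ (Fin 2)} (h : IsCellSolution p L G v g) :
    MemLp g (ENNReal.ofReal p) (volume.restrict (basicCell L G)) := by
  have := isFiniteMeasure_restrict_basicCell hG
  have h1 := h.sub_mem.1.1.memLp_grad.add
    (memLp_const (p := ENNReal.ofReal p) (!₂[(1 : ℝ), 0] : EuclideanSpace ℝ (Fin 2)))
  refine h1.ae_eq (Eventually.of_forall fun y => ?_)
  simp

lemma inner_pFlux_fst (p : ℝ) (s : EuclideanSpace ℝ (Fin 2)) :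
    inner ℝ (pFlux p s) !₂[(1 : ℝ), 0] = ‖s‖ ^ (p - 2) * s 0 := by
  simp [pFlux, PiLp.inner_apply]

lemma IsCellSolution.homogCoeff_eq {p L G₀ G₁ M : ℝ} {G : ℝ → ℝ} (hp : 1 < p)
    (hG : G ∈ AdmissibleProfiles L G₀ G₁ M) {v : ℝ × ℝ → ℝ}
    {g : ℝ × ℝ → EuclideanSpace ℝ (Fin 2)} (h : IsCellSolution p L G v g) :
    homogCoeff p L G g = ∫ y in basicCell L G, ‖g y‖ ^ p := by
  have := isFiniteMeasure_restrict_basicCell hG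
  have hg := h.memLp_grad hG
  have h1 := h.eq_zero _ _ h.sub_mem
  simp_rw [inner_sub_right] at h1
  rw [integral_sub (integrable_inner_pFlux hp hg hg)
    (integrable_inner_pFlux hp hg (memLp_const _))] at h1
  simp_rw [inner_pFlux_self hp, inner_pFlux_fst] at h1
  exact (sub_eq_zero.1 h1).symm

lemma IsCellSolution.homogCoeff_le {p L G₀ G₁ M : ℝ} {G : ℝ → ℝ} (hp : 1 < p) (hL : 0 < L)
    (hG₀ : 0 < G₀) (hG : G ∈ AdmissibleProfiles L G₀ G₁ M) {v : ℝ × ℝ → ℝ}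
    {g : ℝ × ℝ → EuclideanSpace ℝ (Fin 2)} (h : IsCellSolution p L G v g) :
    homogCoeff p L G g ≤ 2 ^ p * (L * G₁) := by
  have := isFiniteMeasure_restrict_basicCell hG
  have hg := h.memLp_grad hG
  have hi := integrable_norm_rpow_of_memLp hp hg
  have h1 : ∀ s : EuclideanSpace ℝ (Fin 2),
      ‖s‖ ^ (p - 2) * s 0 ≤ 1 / 2 * ‖s‖ ^ p + 2 ^ (p - 1) := by
    intro s
    rw [← inner_pFlux_fst]
    refine (inner_pFlux_le hp _ _).trans ?_
    have e : ‖(!₂[(1 : ℝ), 0] : EuclideanSpace ℝ (Fin 2))‖ = 1 := by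
      simp [EuclideanSpace.norm_eq]
    rw [e, mul_one]
    rcases le_total ‖s‖ 2 with h2 | h2
    · have h3 : ‖s‖ ^ (p - 1) ≤ 2 ^ (p - 1) :=
        Real.rpow_le_rpow (norm_nonneg _) h2 (by linarith)
      have := Real.rpow_nonneg (norm_nonneg s) p
      linarith
    · rw [← mul_rpow_sub_one hp (norm_nonneg s)]
      have h3 := Real.rpow_nonneg (norm_nonneg s) (p - 1)
      have h4 : (0 : ℝ) < 2 ^ (p - 1) := by positivity
      nlinarith
  have h2 : homogCoeff p L G g ≤ ∫ y in basicCell L G, (1 / 2 * ‖g y‖ ^ p + 2 ^ (p - 1)) := by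
    refine integral_mono ?_ ((hi.const_mul _).add (integrable_const _)) fun y => h1 (g y)
    have := integrable_inner_pFlux hp hg (memLp_const (!₂[(1 : ℝ), 0]))
    simpa only [inner_pFlux_fst] using this
  rw [integral_add (hi.const_mul _) (integrable_const _), integral_const_mul,
    ← h.homogCoeff_eq hp hG, integral_const, measureReal_restrict_apply_univ, smul_eq_mul] at h2
  have h3 := volume_real_basicCell_le hL hG₀ hG
  have h4 : (2 : ℝ) ^ (p - 1) * 2 = 2 ^ p := mul_rpow_sub_one hp zero_le_two
  have h5 := mul_le_mul_of_nonneg_right h3 (by positivity : (0 : ℝ) ≤ 2 ^ (p - 1))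
  rw [← h4]
  linarith

lemma pullGrad_sub_fst (G H : ℝ → ℝ) (g : ℝ × ℝ → EuclideanSpace ℝ (Fin 2)) (z : ℝ × ℝ) :
    pullGrad G H (fun y => g y - !₂[(1 : ℝ), 0]) z = pullGrad G H g z - !₂[(1 : ℝ), 0] := by
  rw [pullGrad, gradMap_sub, pullGrad]
  congr 1
  ext i
  fin_cases i <;> simp [gradMap]

lemma pullGrad_cellMap {G H : ℝ → ℝ} (hG : ContDiff ℝ 1 G) (hH : ContDiff ℝ 1 H)
    (hG0 : ∀ s, 0 < G s) (hH0 : ∀ s, 0 < H s) (g : ℝ × ℝ → EuclideanSpace ℝ (Fin 2))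
    (z : ℝ × ℝ) : pullGrad H G g (cellMap G H z) =
      gradMap (H z.1 / G z.1)⁻¹ (-(deriv (fun s => H s / G s) z.1 * z.2) / (H z.1 / G z.1))
        (g z) := by
  rw [pullGrad, cellMap_cellMap hG0 hH0, inv_div]
  congr 1
  simp only [cellMap, deriv_div_profile_inv hG hH hG0 hH0]
  have := (hG0 z.1).ne'
  have := (hH0 z.1).ne'
  field_simp

/-- The weak formulation in `Y*_G`, tested with the difference of `u` and the correction of `v`. -/
lemma IsCellSolution.integral_inner_sub_eq_zero {p L G₀ G₁ M : ℝ} {G H : ℝ → ℝ} (hp : 1 < p)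
    (hL : 0 < L) (hG₀ : 0 < G₀) (hG : G ∈ AdmissibleProfiles L G₀ G₁ M)
    (hH : H ∈ AdmissibleProfiles L G₀ G₁ M) {v w : ℝ × ℝ → ℝ}
    {g k : ℝ × ℝ → EuclideanSpace ℝ (Fin 2)} (hv : IsCellSolution p L G v g)
    (hw : IsCellSolution p L H w k) :
    ∫ y in basicCell L G, inner ℝ (pFlux p (g y)) (pullGrad G H k y - g y) = 0 := by
  obtain ⟨φ, hφ⟩ := MemW1pPer.exists_memW1pPerZero_sub hp hL hG₀ hG
    (memW1pPer_comp_cellMap hp hG₀ hG hH hw.sub_mem.1) hv.sub_mem.1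
  have h := hv.eq_zero _ _ hφ
  simpa only [pullGrad_sub_fst, sub_sub_sub_cancel_right] using h

lemma integral_energyGap_eq_zero {p L G₀ G₁ M : ℝ} {G H : ℝ → ℝ} (hp : 1 < p)
    (hL : 0 < L) (hG₀ : 0 < G₀) (hG : G ∈ AdmissibleProfiles L G₀ G₁ M)
    (hH : H ∈ AdmissibleProfiles L G₀ G₁ M) {v w : ℝ × ℝ → ℝ}
    {g k : ℝ × ℝ → EuclideanSpace ℝ (Fin 2)} (hv : IsCellSolution p L G v g)
    (hw : IsCellSolution p L H w k) :
    IntegrableOn (fun z => energyGap p (H z.1 / G z.1)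
      (deriv (fun s => H s / G s) z.1 * z.2) (k (cellMap G H z)) (g z)) (basicCell L G) ∧
    ∫ z in basicCell L G, energyGap p (H z.1 / G z.1)
      (deriv (fun s => H s / G s) z.1 * z.2) (k (cellMap G H z)) (g z) = 0 := by
  have hG0 := AdmissibleProfiles.pos hG₀ hG
  have hH0 := AdmissibleProfiles.pos hG₀ hH
  have hg := hv.memLp_grad hG
  have hk := hw.memLp_grad hH
  have h1 := hv.integral_inner_sub_eq_zero hp hL hG₀ hG hH hw
  have h2 := hw.integral_inner_sub_eq_zero hp hL hG₀ hH hG hv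
  have i1 := integrable_inner_pFlux hp hg ((memLp_pullGrad hp hG₀ hG hH hk).sub hg)
  have i2 := (integrableOn_basicCell_comp hG.1 hH.1 hG0 hH0 _).1
    (integrable_inner_pFlux hp hk (hk.sub (memLp_pullGrad hp hG₀ hH hG hg)))
  have e2 : ∀ y, inner ℝ (pFlux p (k y)) (pullGrad H G g y - k y) =
      -inner ℝ (pFlux p (k y)) (k y - pullGrad H G g y) := fun y => by
    rw [← inner_neg_right, neg_sub]
  simp_rw [e2] at h2
  rw [integral_neg, neg_eq_zero, setIntegral_basicCell_comp hG.1 hH.1 hG0 hH0] at h2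
  simp only [Pi.sub_apply, pullGrad_cellMap hG.1 hH.1 hG0 hH0] at h2 i2
  refine ⟨i2.sub i1, ?_⟩
  have h3 := integral_sub i2 i1
  simp only [Pi.sub_apply] at h3
  rw [h2, h1, sub_zero] at h3
  exact h3

lemma integral_solutionError_le {p L G₀ G₁ M η τ C : ℝ} {G H : ℝ → ℝ} (hp : 1 < p)
    (hL : 0 < L) (hG₀ : 0 < G₀) (hη : 0 < η) (hG : G ∈ AdmissibleProfiles L G₀ G₁ M)
    (hH : H ∈ AdmissibleProfiles L G₀ G₁ M) {v w : ℝ × ℝ → ℝ}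
    {g k : ℝ × ℝ → EuclideanSpace ℝ (Fin 2)} (hv : IsCellSolution p L G v g)
    (hw : IsCellSolution p L H w k)
    (hτ : ∀ r σ : ℝ, |r - 1| < τ → |σ| < τ → ∀ k b : EuclideanSpace ℝ (Fin 2),
      solutionError p r σ k b ≤ η * (r * ‖k‖ ^ p + ‖b‖ ^ p) + C * energyGap p r σ k b)
    (hr : ∀ z ∈ basicCell L G, |H z.1 / G z.1 - 1| < τ)
    (hσ : ∀ z ∈ basicCell L G, |deriv (fun s => H s / G s) z.1 * z.2| < τ) :
    (∫ z in basicCell L G, ‖pullGrad G H k z - g z‖ ^ p) ≤ η * (2 * (2 ^ p * (L * G₁))) ∧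
    |homogCoeff p L H k - homogCoeff p L G g| ≤ η * (2 * (2 ^ p * (L * G₁))) := by
  have hG0 := AdmissibleProfiles.pos hG₀ hG
  have hH0 := AdmissibleProfiles.pos hG₀ hH
  have hg := hv.memLp_grad hG
  have hk := hw.memLp_grad hH
  obtain ⟨i0, h0⟩ := integral_energyGap_eq_zero hp hL hG₀ hG hH hv hw
  have i1 : IntegrableOn (fun z => ‖pullGrad G H k z - g z‖ ^ p) (basicCell L G) :=
    integrable_norm_rpow_of_memLp hp ((memLp_pullGrad hp hG₀ hG hH hk).sub hg)
  have i2 := integrable_norm_rpow_of_memLp hp hg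
  have i3 := (integrableOn_basicCell_comp hG.1 hH.1 hG0 hH0 _).1
    (integrable_norm_rpow_of_memLp hp hk)
  have i4 : IntegrableOn (fun z => |H z.1 / G z.1 * ‖k (cellMap G H z)‖ ^ p - ‖g z‖ ^ p|)
    (basicCell L G) := (i3.sub i2).abs
  have hqH := hw.homogCoeff_eq hp hH
  rw [setIntegral_basicCell_comp hG.1 hH.1 hG0 hH0] at hqH
  have hqG := hv.homogCoeff_eq hp hG
  have hle : (∫ z in basicCell L G, (‖pullGrad G H k z - g z‖ ^ p +
      |H z.1 / G z.1 * ‖k (cellMap G H z)‖ ^ p - ‖g z‖ ^ p|)) ≤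
      ∫ z in basicCell L G, (η * (H z.1 / G z.1 * ‖k (cellMap G H z)‖ ^ p + ‖g z‖ ^ p) +
        C * energyGap p (H z.1 / G z.1) (deriv (fun s => H s / G s) z.1 * z.2)
          (k (cellMap G H z)) (g z)) :=
    setIntegral_mono_on (i1.add i4) (((i3.add i2).const_mul η).add (i0.const_mul C))
      (isOpen_basicCell hG.1.continuous).measurableSet
      fun z hz => hτ _ _ (hr z hz) (hσ z hz) _ _
  have i32 : IntegrableOn (fun z => η * (H z.1 / G z.1 * ‖k (cellMap G H z)‖ ^ p + ‖g z‖ ^ p))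
    (basicCell L G) := (i3.add i2).const_mul η
  rw [integral_add i1 i4, integral_add i32 (i0.const_mul C), integral_const_mul,
    integral_const_mul, h0, mul_zero, add_zero, integral_add i3 i2, ← hqH, ← hqG] at hle
  have hb : η * (homogCoeff p L H k + homogCoeff p L G g) ≤ η * (2 * (2 ^ p * (L * G₁))) := by
    gcongr
    have := hv.homogCoeff_le hp hL hG₀ hG
    have := hw.homogCoeff_le hp hL hG₀ hH
    linarith
  have p1 : 0 ≤ ∫ z in basicCell L G, ‖pullGrad G H k z - g z‖ ^ p :=
    integral_nonneg fun z => by positivity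
  have p2 : |homogCoeff p L H k - homogCoeff p L G g| ≤
      ∫ z in basicCell L G, |H z.1 / G z.1 * ‖k (cellMap G H z)‖ ^ p - ‖g z‖ ^ p| := by
    rw [hqH, hqG, ← integral_sub i3 i2]
    exact abs_integral_le_integral_abs
  have p3 := abs_nonneg (homogCoeff p L H k - homogCoeff p L G g)
  constructor <;> linarith

lemma abs_le_of_c1Norm_le {L G₀ G₁ M δ : ℝ} {G H : ℝ → ℝ}
    (hG : G ∈ AdmissibleProfiles L G₀ G₁ M) (hH : H ∈ AdmissibleProfiles L G₀ G₁ M)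
    (h : c1Norm (fun s => H s - G s) ≤ δ) (s : ℝ) :
    |H s - G s| ≤ δ ∧ |deriv H s - deriv G s| ≤ δ := by
  have hd : ∀ s, deriv (fun s => H s - G s) s = deriv H s - deriv G s := fun s =>
    deriv_fun_sub (hH.1.differentiable one_ne_zero s) (hG.1.differentiable one_ne_zero s)
  have h1 : BddAbove (range fun s => |H s - G s|) := by
    refine ⟨G₁ - G₀, ?_⟩
    rintro _ ⟨s, rfl⟩
    have := hG.2.2.1 s
    have := hH.2.2.1 s
    exact abs_le.2 ⟨by linarith, by linarith⟩
  have h2 : BddAbove (range fun s => |deriv (fun s => H s - G s) s|) := by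
    refine ⟨M + M, ?_⟩
    rintro _ ⟨s, rfl⟩
    dsimp only
    rw [hd]
    exact (abs_sub _ _).trans (add_le_add (hH.2.2.2 s) (hG.2.2.2 s))
  have h3 := le_ciSup h1 s
  have h4 := le_ciSup h2 s
  have h5 : 0 ≤ ⨆ s, |H s - G s| := Real.iSup_nonneg fun s => abs_nonneg _
  have h6 : 0 ≤ ⨆ s, |deriv (fun s => H s - G s) s| := Real.iSup_nonneg fun s => abs_nonneg _
  rw [c1Norm] at h
  rw [← hd]
  constructor <;> linarith

lemma abs_div_profile_sub_one_le {L G₀ G₁ M δ : ℝ} {G H : ℝ → ℝ} (hG₀ : 0 < G₀)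
    (hG : G ∈ AdmissibleProfiles L G₀ G₁ M) (hH : H ∈ AdmissibleProfiles L G₀ G₁ M)
    (h : c1Norm (fun s => H s - G s) ≤ δ) (s : ℝ) : |H s / G s - 1| ≤ δ * (1 / G₀) := by
  have h0 := AdmissibleProfiles.pos hG₀ hG s
  obtain ⟨h1, -⟩ := abs_le_of_c1Norm_le hG hH h s
  have e : H s / G s - 1 = (H s - G s) * (1 / G s) := by field_simp
  rw [e, abs_mul, abs_of_pos (one_div_pos.2 h0)]
  gcongr
  · exact (abs_nonneg _).trans h1
  · exact (hG.2.2.1 s).1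

lemma abs_deriv_div_profile_le {L G₀ G₁ M δ : ℝ} {G H : ℝ → ℝ} (hG₀ : 0 < G₀)
    (hG : G ∈ AdmissibleProfiles L G₀ G₁ M) (hH : H ∈ AdmissibleProfiles L G₀ G₁ M)
    (h : c1Norm (fun s => H s - G s) ≤ δ) (s : ℝ) :
    |deriv (fun s => H s / G s) s| ≤ δ * (1 / G₀ + M / G₀ ^ 2) := by
  have h0 := AdmissibleProfiles.pos hG₀ hG s
  obtain ⟨h1, h2⟩ := abs_le_of_c1Norm_le hG hH h s
  have hδ : 0 ≤ δ := (abs_nonneg _).trans h1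
  have e : deriv (fun s => H s / G s) s =
      (deriv H s - deriv G s) * (1 / G s) - (H s - G s) * (deriv G s / G s ^ 2) := by
    rw [deriv_fun_div (hH.1.differentiable one_ne_zero s) (hG.1.differentiable one_ne_zero s)
      h0.ne']
    field_simp
    ring
  rw [e, mul_add]
  refine (abs_sub _ _).trans (add_le_add ?_ ?_)
  · rw [abs_mul, abs_of_pos (one_div_pos.2 h0)]
    gcongr
    exact (hG.2.2.1 s).1
  · rw [abs_mul, abs_div, abs_of_pos (pow_pos h0 2)]
    gcongr
    · exact (abs_nonneg _).trans (hG.2.2.2 s)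
    · exact hG.2.2.2 s
    · exact (hG.2.2.1 s).1

lemma IsCellSolution.memW1p {p L G₀ G₁ M : ℝ} {G : ℝ → ℝ} (hp : 1 < p)
    (hG : G ∈ AdmissibleProfiles L G₀ G₁ M) {v : ℝ × ℝ → ℝ}
    {g : ℝ × ℝ → EuclideanSpace ℝ (Fin 2)} (h : IsCellSolution p L G v g) :
    MemW1p p (basicCell L G) v g := by
  have h1 := h.sub_mem.1.1.sub hp hG (memW1p_const_mul_fst hG (-1))
  have e : ∀ y, g y - !₂[(1 : ℝ), 0] - !₂[(-1 : ℝ), 0] = g y := fun y => by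
    ext i
    fin_cases i <;> simp
  simpa [e] using h1

end Stability

theorem mainTheorem5 (p G₀ G₁ : ℝ) (hp : 1 < p) (hG₀ : 0 < G₀) :
    ∃ c : ℝ, 0 < c ∧ ∀ L M : ℝ, 0 < L → 0 < M → ∀ ε : ℝ, 0 < ε → ∃ δ : ℝ, 0 < δ ∧
      ∀ G ∈ AdmissibleProfiles L G₀ G₁ M, ∀ Gbar ∈ AdmissibleProfiles L G₀ G₁ M,
        c1Norm (fun s => Gbar s - G s) ≤ δ →
        ∀ (v vbar : ℝ × ℝ → ℝ) (g gbar : ℝ × ℝ → EuclideanSpace ℝ (Fin 2)),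
          IsCellSolution p L G v g → IsCellSolution p L Gbar vbar gbar →
          (∃ h : ℝ × ℝ → EuclideanSpace ℝ (Fin 2),
            MemW1p p (basicCell L G) (fun z => vbar (cellMap G Gbar z)) h ∧
            eLpNorm (fun z => h z - g z) (ENNReal.ofReal p) (volume.restrict (basicCell L G)) ≤
              ENNReal.ofReal (c * (ε + ε ^ rateExponent p))) ∧
          |homogCoeff p L Gbar gbar - homogCoeff p L G g| ≤ c * (ε + ε ^ rateExponent p) := by
  have hp0 : 0 < p := by linarith
  refine ⟨1, one_pos, fun L M hL hM ε hε => ?_⟩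
  rw [one_mul]
  set T := ε + ε ^ rateExponent p with hT
  have hT0 : 0 < T := by positivity
  have hTp : 0 < T ^ p := Real.rpow_pos_of_pos hT0 p
  set K := 2 * (2 ^ p * (L * |G₁|)) + 1 with hK
  have hK0 : 0 < K := by positivity
  have hη : 0 < min (T ^ p) T / K := div_pos (lt_min hTp hT0) hK0
  obtain ⟨τ, hτ0, C, hτ⟩ := exists_solutionError_le hp hη
  set B := 1 + 1 / G₀ + (1 / G₀ + M / G₀ ^ 2) * |G₁| with hB
  have hB0 : 0 < B := by positivity
  refine ⟨τ / B, div_pos hτ0 hB0, fun G hG H hH hδ v w g k hv hw => ?_⟩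
  have hG1 : 0 ≤ G₁ := (AdmissibleProfiles.pos hG₀ hG 0).le.trans (hG.2.2.1 0).2
  rw [abs_of_nonneg hG1] at hK hB
  have hτB : ∀ a, a < B → τ / B * a < τ := fun a ha => by
    rw [div_mul_eq_mul_div, div_lt_iff₀ hB0]
    gcongr
  have hr : ∀ z ∈ basicCell L G, |H z.1 / G z.1 - 1| < τ := fun z _ =>
    (abs_div_profile_sub_one_le hG₀ hG hH hδ z.1).trans_lt <| hτB _ <| by
      have : 0 ≤ (1 / G₀ + M / G₀ ^ 2) * G₁ := by positivity
      linarith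
  have hσ : ∀ z ∈ basicCell L G, |deriv (fun s => H s / G s) z.1 * z.2| < τ := fun z hz => by
    have h1 := abs_deriv_div_profile_le hG₀ hG hH hδ z.1
    have h2 := (basicCell_subset_Icc hG hz).2
    rw [abs_mul, abs_of_nonneg h2.1]
    calc _ ≤ τ / B * (1 / G₀ + M / G₀ ^ 2) * G₁ :=
          mul_le_mul h1 h2.2 h2.1 (by positivity)
      _ = τ / B * ((1 / G₀ + M / G₀ ^ 2) * G₁) := by ring
      _ < τ := hτB _ (by
        have : 0 < 1 / G₀ := by positivity
        linarith)
  obtain ⟨h1, h2⟩ := integral_solutionError_le hp hL hG₀ hη hG hH hv hw hτ hr hσ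
  have h3 : min (T ^ p) T / K * (2 * (2 ^ p * (L * G₁))) ≤ min (T ^ p) T := by
    rw [div_mul_eq_mul_div, div_le_iff₀ hK0]
    have := (lt_min hTp hT0).le
    gcongr
    linarith
  refine ⟨⟨pullGrad G H k, (memW1p_comp_cellMap hp hG₀ hG hH (hw.memW1p hp hH)).1, ?_⟩,
    h2.trans (h3.trans (min_le_right _ _))⟩
  have hmem : MemLp (fun z => pullGrad G H k z - g z) (ENNReal.ofReal p)
      (volume.restrict (basicCell L G)) :=
    (memLp_pullGrad hp hG₀ hG hH (hw.memLp_grad hH)).sub (hv.memLp_grad hG)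
  rw [hmem.eLpNorm_eq_integral_rpow_norm (by simpa using hp0) ENNReal.ofReal_ne_top,
    ENNReal.toReal_ofReal hp0.le]
  refine ENNReal.ofReal_le_ofReal ?_
  calc _ ≤ (T ^ p) ^ p⁻¹ := Real.rpow_le_rpow (integral_nonneg fun z => by positivity)
        (h1.trans (h3.trans (min_le_left _ _))) (by positivity)
    _ = T := Real.rpow_rpow_inv hT0.le hp0.ne'
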